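/- Consider the coupled string--beam system $(\mathcal S_0)$ $$u^1_{tt}-u^1_{xx}=0,\qquad u^2_{tt}+u^2_{xxxx}=0\qquad\text{in }(0,\pi)\times(0,\infty),$$ $$u^1(0,t)=u^2(0,t),\quad u^2_x(0,t)=0,\quad u^2_{xxx}(0,t)=u^1_x(0,t),$$ $$u^1(\pi,t)=0,\quad u^2_{xxx}(\pi,t)=u^2_t(\pi,t),\quad u^2_x(\pi,t)=0,$$ that is, a string and a beam of length $\pi$ joined at $x=0$, with the feedback applied at the end $x=\pi$ of the beam. Let $$V=\{(u^1,u^2)\in H^1(0,\pi)\times H^2(0,\pi): u^1(\pi)=0,\ u^1(0)=u^2(0),\ \partial_xu^2(0)=\partial_xu^2(\pi)=0\}$$ (complex-valued functions), and let $\mathcal H=V\times L^2(0,\pi)\times L^2(0,\pi)$ be the energy space, with norm $$\|(u^1,u^2,v^1,v^2)\|^2=\|\partial_xu^1\|_{L^2}^2+\|\partial_x^2u^2\|_{L^2}^2+\|v^1\|_{L^2}^2+\|v^2\|_{L^2}^2 .$$ Let $\mathcal A(u^1,u^2,v^1,v^2)=(v^1,v^2,\partial_x^2u^1,-\partial_x^4u^2)$,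 with domain $D(\mathcal A)$ the set of all $(u,v)\in V\times V$ such that $u^1\in H^2(0,\pi)$, $u^2\in H^4(0,\pi)$, $\partial_x^3u^2(0)=\partial_xu^1(0)$ and $\partial_x^3u^2(\pi)=v^2(\pi)$. **Theorem.** The operator $\mathcal A$ generates a unique $C_0$-semigroup $(T(t))_{t\ge0}$ on $\mathcal H$, and this semigroup is not exponentially stable: there are no constants $M$ and $\omega>0$ with $\|T(t)\|\le Me^{-\omega t}$ for all $t\ge0$. More precisely, for the integers $n\ge1$ such that $\sqrt n$ is an even integer let $$\beta_n=n^2+2\sqrt n+\frac1n,\qquad f_n=(0,0,-\sin(\beta_n x),0)\in\mathcal H .$$ Then, as $n\to\infty$ along these integers, $\beta_n\to+\infty$; the sequence $(f_n)$ is bounded in $\mathcal H$; for each such $n$ the equation $(\mathcal A-i\beta_n)y_n=f_n$ has exactly one solution $y_n\in D(\mathcal A)$; and $\|y_n\|\to\infty$. Each $i\beta_n$ belongs to the resolvent set of $\mathcal A$, and $\|(i\beta_n-\mathcal A)^{-1}\|\to\infty$; in particular the resolvent of $\mathcal A$ is unbounded on the imaginary axis. -/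

import Mathlib

open MeasureTheory Set Filter Topology
open scoped NNReal ENNReal

/-! ## Strongly continuous semigroups, generators, exponential stability, resolvents -/

/-- A strongly continuous (`C₀`-) semigroup of bounded operators on `H`, indexed by `t ≥ 0`. -/
structure C0Semigroup (H : Type*) [NormedAddCommGroup H] [NormedSpace ℂ H] where
  /-- The operator `T(t)`. -/
  op : ℝ≥0 → H →L[ℂ] H
  op_zero : op 0 = ContinuousLinearMap.id ℂ H
  op_add : ∀ s t, op (s + t) = (op s).comp (op t)
  continuous_orbit : ∀ x, Continuous fun t => op t x

section Abstract

variable {H : Type*} [NormedAddCommGroup H] [NormedSpace ℂ H]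

/-- The (unbounded) operator `A` is the infinitesimal generator of `T`: `x ∈ D(A)` and `A x = y`
if and only if `(T(t)x - x) / t → y` as `t → 0+`. -/
def C0Semigroup.HasGenerator (T : C0Semigroup H) (A : H →ₗ.[ℂ] H) : Prop :=
  ∀ x y : H, (x, y) ∈ A.graph ↔
    Tendsto (fun t : ℝ≥0 => (((t : ℝ) : ℂ))⁻¹ • (T.op t x - x)) (𝓝[>] 0) (𝓝 y)

/-- `‖T(t)‖ ≤ M exp(-ω t)` for all `t ≥ 0`, for some constants `M` and `ω > 0`. -/
def C0Semigroup.ExponentiallyStable (T : C0Semigroup H) : Prop :=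
  ∃ M ω : ℝ, 0 < ω ∧ ∀ t : ℝ≥0, ‖T.op t‖ ≤ M * Real.exp (-ω * t)

/-- The complex number `z` is in the resolvent set of `A`, and the bounded operator `R` is
`(z - A)⁻¹`. -/
structure IsResolventAt (A : H →ₗ.[ℂ] H) (z : ℂ) (R : H →L[ℂ] H) : Prop where
  right_inv : ∀ f : H, ∃ y : A.domain, (y : H) = R f ∧ z • (y : H) - A y = f
  left_inv : ∀ y : A.domain, R (z • (y : H) - A y) = y

end Abstract

namespace StringBeam

noncomputable section

/-! ## Function spaces on the interval `(0, π)` -/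

/-- The closed interval `[0, π]`. -/
abbrev Iv : Type := Icc (0 : ℝ) Real.pi

/-- The left end point `0` (where the string and the beam are joined). -/
def left : Iv := ⟨0, left_mem_Icc.2 Real.pi_pos.le⟩

/-- The right end point `π` (the fixed end of the string, the controlled end of the beam). -/
def right : Iv := ⟨Real.pi, right_mem_Icc.2 Real.pi_pos.le⟩

/-- Complex valued continuous functions on `[0, π]`. -/
abbrev Cont : Type := C(Iv, ℂ)

/-- Lebesgue measure on `(0, π)`. -/
abbrev vol : Measure ℝ := volume.restrict (Ioo (0 : ℝ) Real.pi)

/-- The complex space `L²(0, π)`. -/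
abbrev L2 : Type := Lp ℂ 2 vol

/-- A continuous function on `[0, π]`, extended to `ℝ` by constants. -/
def ext (F : Cont) : ℝ → ℂ := IccExtend Real.pi_pos.le F

/-- `F(x) = F(0) + ∫₀ˣ g` for all `x ∈ [0, π]`. -/
def IsPrimitive (F : Cont) (g : ℝ → ℂ) : Prop :=
  ∀ x : Iv, F x = F left + ∫ t in (0 : ℝ)..x, g t

lemma ext_continuous (F : Cont) : Continuous (ext F) := F.continuous.Icc_extend'

lemma ext_coe (F : Cont) (x : Iv) : ext F x = F x := IccExtend_val _ _ x

lemma memLp_ext (F : Cont) : MemLp (ext F) 2 vol :=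
  MemLp.of_bound (ext_continuous F).aestronglyMeasurable ‖F‖
    (ae_of_all _ fun _ => F.norm_coe_le_norm _)

/-- The class in `L²(0, π)` of a continuous function. -/
def toL2 : Cont →ₗ[ℂ] L2 where
  toFun F := (memLp_ext F).toLp (ext F)
  map_add' _ _ := rfl
  map_smul' _ _ := rfl

lemma toL2_coe (F : Cont) : (toL2 F : ℝ → ℂ) =ᵐ[vol] ext F := (memLp_ext F).coeFn_toLp

lemma ae_uIoc {p : ℝ → Prop} (h : ∀ᵐ t ∂vol, p t) {x : ℝ} (hx : x ∈ Icc (0 : ℝ) Real.pi) :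
    ∀ᵐ t, t ∈ uIoc 0 x → p t := by
  have h' : ∀ᵐ t ∂(volume.restrict (Ioc (0 : ℝ) Real.pi)), p t := by
    rwa [← restrict_Ioo_eq_restrict_Ioc]
  rw [ae_restrict_iff' measurableSet_Ioc] at h'
  filter_upwards [h'] with t ht hm
  rw [uIoc_of_le hx.1] at hm
  exact ht ⟨hm.1, hm.2.trans hx.2⟩

lemma integral_congr {g k : ℝ → ℂ} (h : g =ᵐ[vol] k) (x : Iv) :
    ∫ t in (0 : ℝ)..x, g t = ∫ t in (0 : ℝ)..x, k t :=
  intervalIntegral.integral_congr_ae (ae_uIoc h x.2)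

lemma L2_intervalIntegrable (g : L2) (x : Iv) : IntervalIntegrable g volume 0 x := by
  have h : IntegrableOn g (Ioc (0 : ℝ) Real.pi) := by
    have : Integrable g vol := (Lp.memLp g).integrable (by norm_num)
    rwa [IntegrableOn, ← restrict_Ioo_eq_restrict_Ioc]
  rw [intervalIntegrable_iff_integrableOn_Ioc_of_le x.2.1]
  exact h.mono_set (Ioc_subset_Ioc_right x.2.2)

lemma IsPrimitive.add {F G : Cont} {f g : ℝ → ℂ} (hF : IsPrimitive F f) (hG : IsPrimitive G g)
    (hf : ∀ x : Iv, IntervalIntegrable f volume 0 x)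
    (hg : ∀ x : Iv, IntervalIntegrable g volume 0 x) :
    IsPrimitive (F + G) (fun t => f t + g t) := by
  intro x
  rw [intervalIntegral.integral_add (hf x) (hg x)]
  simp only [ContinuousMap.add_apply]
  rw [hF x, hG x]
  ring

lemma IsPrimitive.smul {F : Cont} {f : ℝ → ℂ} (c : ℂ) (hF : IsPrimitive F f) :
    IsPrimitive (c • F) (fun t => c • f t) := by
  intro x
  rw [intervalIntegral.integral_smul]
  simp only [ContinuousMap.smul_apply]
  rw [hF x, smul_add]

lemma IsPrimitive.congr {F : Cont} {f g : ℝ → ℂ} (hF : IsPrimitive F f) (h : f =ᵐ[vol] g) :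
    IsPrimitive F g := fun x => by rw [hF x, integral_congr h x]

lemma IsPrimitive.eq_of_ae_zero {F : Cont} {f : ℝ → ℂ} (hF : IsPrimitive F f)
    (h : f =ᵐ[vol] 0) (x : Iv) : F x = F left := by
  rw [hF x, integral_congr h x]
  simp

/-- `H¹(0, π)`: each function is stored together with its derivative, as a pair `(f, f')`
with `f` continuous on `[0, π]`, `f' ∈ L²(0, π)` and `f(x) = f(0) + ∫₀ˣ f'`
(that is, `f` is absolutely continuous with derivative `f'` in `L²`). -/
def H1 : Submodule ℂ (Cont × L2) where
  carrier := {f | IsPrimitive f.1 f.2}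
  zero_mem' := by
    intro x
    refine Eq.trans ?_ (congrArg (_ + ·) (integral_congr (Lp.coeFn_zero ℂ 2 vol) x).symm)
    simp
  add_mem' {f g} hf hg :=
    (IsPrimitive.add hf hg (L2_intervalIntegrable _) (L2_intervalIntegrable _)).congr
      (Lp.coeFn_add f.2 g.2).symm
  smul_mem' c f hf := (IsPrimitive.smul c hf).congr (Lp.coeFn_smul c f.2).symm

/-- `H²(0, π)`: each function is stored together with its derivatives, as a triple
`(f, f', f'')` with `f` and `f'` continuous on `[0, π]`, `f'' ∈ L²(0, π)`,
`f(x) = f(0) + ∫₀ˣ f'` and `f'(x) = f'(0) + ∫₀ˣ f''`. -/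
def H2 : Submodule ℂ (Cont × Cont × L2) where
  carrier := {f | IsPrimitive f.1 (ext f.2.1) ∧ IsPrimitive f.2.1 f.2.2}
  zero_mem' := ⟨fun x => by simp [ext, IccExtend], H1.zero_mem⟩
  add_mem' {f g} hf hg :=
    ⟨IsPrimitive.add hf.1 hg.1 (fun _ => (ext_continuous _).intervalIntegrable _ _)
      (fun _ => (ext_continuous _).intervalIntegrable _ _),
      H1.add_mem (x := f.2) (y := g.2) hf.2 hg.2⟩
  smul_mem' c f hf := ⟨IsPrimitive.smul c hf.1, H1.smul_mem c (x := f.2) hf.2⟩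

/-- `f`, for `f ∈ H¹`. -/
def h1val (f : H1) : Cont := f.1.1
/-- `f'`, for `f ∈ H¹`. -/
def h1deriv (f : H1) : L2 := f.1.2
/-- `f`, for `f ∈ H²`. -/
def h2val (f : H2) : Cont := f.1.1
/-- `f'`, for `f ∈ H²`. -/
def h2deriv (f : H2) : Cont := f.1.2.1
/-- `f''`, for `f ∈ H²`. -/
def h2deriv2 (f : H2) : L2 := f.1.2.2

/-! ## The energy space -/

/-- The space `V` of pairs `u = (u¹, u²) ∈ H¹(0, π) × H²(0, π)` with
`u¹(π) = 0`, `u¹(0) = u²(0)`, `∂ₓu²(0) = 0`, `∂ₓu²(π) = 0`. -/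
def V : Submodule ℂ ((Cont × L2) × (Cont × Cont × L2)) where
  carrier := {u | ∃ (f : H1) (g : H2), u = (f.1, g.1) ∧
    h1val f right = 0 ∧ h1val f left = h2val g left ∧ h2deriv g left = 0 ∧ h2deriv g right = 0}
  zero_mem' := ⟨0, 0, rfl, rfl, rfl, rfl, rfl⟩
  add_mem' := by
    rintro _ _ ⟨f, g, rfl, a, b, c, d⟩ ⟨f', g', rfl, a', b', c', d'⟩
    exact ⟨f + f', g + g', rfl, (congrArg₂ (· + ·) a a').trans (add_zero 0),
      congrArg₂ (· + ·) b b', (congrArg₂ (· + ·) c c').trans (add_zero 0),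
      (congrArg₂ (· + ·) d d').trans (add_zero 0)⟩
  smul_mem' := by
    rintro r _ ⟨f, g, rfl, a, b, c, d⟩
    exact ⟨r • f, r • g, rfl, (congrArg (r • ·) a).trans (smul_zero r), congrArg (r • ·) b,
      (congrArg (r • ·) c).trans (smul_zero r), (congrArg (r • ·) d).trans (smul_zero r)⟩

lemma V_fst {u : (Cont × L2) × (Cont × Cont × L2)} (hu : u ∈ V) : u.1 ∈ H1 := by
  obtain ⟨f, g, rfl, -⟩ := hu
  exact f.2

lemma V_snd {u : (Cont × L2) × (Cont × Cont × L2)} (hu : u ∈ V) : u.2 ∈ H2 := by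
  obtain ⟨f, g, rfl, -⟩ := hu
  exact g.2

/-- The energy space `ℋ = V × L²(0, π) × L²(0, π)`, with elements `y = (u, v¹, v²)`,
`u = (u¹, u²) ∈ V`; its norm comes from the energy inner product below. -/
def EnergySpace : Type := V × L2 × L2

instance : AddCommGroup EnergySpace := inferInstanceAs (AddCommGroup (V × L2 × L2))
instance : Module ℂ EnergySpace := inferInstanceAs (Module ℂ (V × L2 × L2))

/-- `u¹ ∈ H¹`. -/
def EnergySpace.u1 (y : EnergySpace) : H1 := ⟨y.1.1.1, V_fst y.1.2⟩
/-- `u² ∈ H²`. -/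
def EnergySpace.u2 (y : EnergySpace) : H2 := ⟨y.1.1.2, V_snd y.1.2⟩
/-- `v¹ ∈ L²`. -/
def EnergySpace.v1 (y : EnergySpace) : L2 := y.2.1
/-- `v² ∈ L²`. -/
def EnergySpace.v2 (y : EnergySpace) : L2 := y.2.2

/-- The energy inner product
`⟪∂ₓu¹, ∂ₓũ¹⟫ + ⟪∂ₓ²u², ∂ₓ²ũ²⟫ + ⟪v¹, ṽ¹⟫ + ⟪v², ṽ²⟫` (inner products of `L²(0, π)`). -/
def energyInner (y z : EnergySpace) : ℂ :=
  inner ℂ (h1deriv y.u1) (h1deriv z.u1) + inner ℂ (h2deriv2 y.u2) (h2deriv2 z.u2)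
    + inner ℂ y.v1 z.v1 + inner ℂ y.v2 z.v2

lemma V_eq_zero {u : V} (h1 : u.1.1.2 = 0) (h2 : u.1.2.2.2 = 0) : u = 0 := by
  obtain ⟨u, ⟨⟨⟨a, a'⟩, ha⟩, ⟨⟨b, b', b''⟩, hb⟩, rfl, e1, e2, e3, e4⟩⟩ := u
  change a' = 0 at h1
  change b'' = 0 at h2
  subst h1
  subst h2
  change a right = 0 at e1
  change a left = b left at e2
  change b' left = 0 at e3
  have ha0 := IsPrimitive.eq_of_ae_zero (F := a) ha (Lp.coeFn_zero ℂ 2 vol)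
  have hb1 := IsPrimitive.eq_of_ae_zero (F := b') hb.2 (Lp.coeFn_zero ℂ 2 vol)
  have hb' : b' = 0 := by
    ext x
    rw [hb1 x, e3]
    rfl
  have hb0 := IsPrimitive.eq_of_ae_zero (F := b) hb.1 (ae_of_all _ fun t => by
    change ext b' t = 0
    rw [hb']
    rfl)
  have hal : a left = 0 := by rw [← ha0 right, e1]
  have ha' : a = 0 := by
    ext x
    rw [ha0 x, hal]
    rfl
  have hb'' : b = 0 := by
    ext x
    rw [hb0 x, ← e2, hal]
    rfl
  subst ha' hb' hb''
  rfl

/-- `energyInner` is an inner product. -/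
@[reducible] def energyCore : InnerProductSpace.Core ℂ EnergySpace where
  inner := energyInner
  conj_inner_symm y z := by simp [energyInner]
  re_inner_nonneg y := by
    simp only [energyInner, map_add]
    have h := fun x : L2 => inner_self_nonneg (𝕜 := ℂ) (x := x)
    exact add_nonneg (add_nonneg (add_nonneg (h _) (h _)) (h _)) (h _)
  add_left x y z := by
    change inner ℂ (h1deriv x.u1 + h1deriv y.u1) _ + inner ℂ (h2deriv2 x.u2 + h2deriv2 y.u2) _
      + inner ℂ (x.v1 + y.v1) _ + inner ℂ (x.v2 + y.v2) _ = _
    simp only [energyInner, inner_add_left]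
    ring
  smul_left x y r := by
    change inner ℂ (r • h1deriv x.u1) _ + inner ℂ (r • h2deriv2 x.u2) _
      + inner ℂ (r • x.v1) _ + inner ℂ (r • x.v2) _ = _
    simp only [energyInner, inner_smul_left]
    ring
  definite y hy := by
    have hre := congrArg Complex.re hy
    have h := fun x : L2 => inner_self_nonneg (𝕜 := ℂ) (x := x)
    have hz : ∀ x : L2, (inner ℂ x x).re = 0 → x = 0 := fun x hx => by
      have := inner_self_eq_norm_sq (𝕜 := ℂ) x
      rw [RCLike.re_to_complex, hx] at this
      exact norm_eq_zero.1 (pow_eq_zero_iff two_ne_zero |>.1 this.symm)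
    simp only [energyInner, Complex.add_re, Complex.zero_re] at hre
    have a := h (h1deriv y.u1)
    have b := h (h2deriv2 y.u2)
    have c := h y.v1
    have d := h y.v2
    simp only [RCLike.re_to_complex] at a b c d
    have e1 := hz (h1deriv y.u1) (by linarith)
    have e2 := hz (h2deriv2 y.u2) (by linarith)
    have e3 := hz y.v1 (by linarith)
    have e4 := hz y.v2 (by linarith)
    exact Prod.ext (V_eq_zero e1 e2) (Prod.ext e3 e4)

instance : NormedAddCommGroup EnergySpace := energyCore.toNormedAddCommGroup
instance : InnerProductSpace ℂ EnergySpace := InnerProductSpace.ofCore energyCore.toCore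

/-! ## The operator of the system -/

/-- The graph of the operator `𝒜` of the string-beam system: the pairs `(y, z)`, where
`y = (u, v¹, v²)` and `z = (w, g¹, g²)`, such that
* `v = (v¹, v²)` is in `V`, and `w = v`;
* `u¹ ∈ H²`, that is, `∂ₓu¹` is (the class of) some `p ∈ H¹`, and `g¹ = ∂ₓp = ∂ₓ²u¹`;
* `u² ∈ H⁴`, that is, `∂ₓ²u²` is (the class of) some `q ∈ H²`, and `g² = -∂ₓ²q = -∂ₓ⁴u²`;
* `∂ₓ³u²(0) = ∂ₓu¹(0)` (transmission) and `∂ₓ³u²(π) = v²(π)` (feedback). -/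
def opGraph : Submodule ℂ (EnergySpace × EnergySpace) where
  carrier := {yz |
    toL2 (h1val yz.2.u1) = yz.1.v1 ∧ toL2 (h2val yz.2.u2) = yz.1.v2 ∧
    ∃ (p : H1) (q : H2),
      toL2 (h1val p) = h1deriv yz.1.u1 ∧ yz.2.v1 = h1deriv p ∧
      toL2 (h2val q) = h2deriv2 yz.1.u2 ∧ yz.2.v2 = -h2deriv2 q ∧
      h2deriv q left = h1val p left ∧
      h2deriv q right = h2val yz.2.u2 right}
  zero_mem' := ⟨map_zero toL2, map_zero toL2, 0, 0, map_zero toL2, rfl, map_zero toL2,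
    neg_zero.symm, rfl, rfl⟩
  add_mem' {y z} hy hz := by
    obtain ⟨a, b, p, q, c, d, e, f, g, h⟩ := hy
    obtain ⟨a', b', p', q', c', d', e', f', g', h'⟩ := hz
    exact ⟨(map_add toL2 _ _).trans (congrArg₂ (· + ·) a a'),
      (map_add toL2 _ _).trans (congrArg₂ (· + ·) b b'), p + p', q + q',
      (map_add toL2 _ _).trans (congrArg₂ (· + ·) c c'), congrArg₂ (· + ·) d d',
      (map_add toL2 _ _).trans (congrArg₂ (· + ·) e e'),
      (congrArg₂ (· + ·) f f').trans (neg_add _ _).symm,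
      congrArg₂ (· + ·) g g', congrArg₂ (· + ·) h h'⟩
  smul_mem' r y hy := by
    obtain ⟨a, b, p, q, c, d, e, f, g, h⟩ := hy
    exact ⟨(map_smul toL2 r _).trans (congrArg (r • ·) a),
      (map_smul toL2 r _).trans (congrArg (r • ·) b), r • p, r • q,
      (map_smul toL2 r _).trans (congrArg (r • ·) c), congrArg (r • ·) d,
      (map_smul toL2 r _).trans (congrArg (r • ·) e),
      (congrArg (r • ·) f).trans (smul_neg _ _),
      congrArg (r • ·) g, congrArg (r • ·) h⟩

/-- The operator `𝒜` on the energy space. -/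
def op : EnergySpace →ₗ.[ℂ] EnergySpace := opGraph.toLinearPMap

lemma toL2_injective : Function.Injective toL2 := by
  rw [injective_iff_map_eq_zero]
  intro F hF
  have h : ext F =ᵐ[volume.restrict (Icc (0 : ℝ) Real.pi)] fun _ => (0 : ℂ) := by
    rw [← restrict_Ioo_eq_restrict_Icc]
    have h1 := toL2_coe F
    rw [hF] at h1
    exact h1.symm.trans (Lp.coeFn_zero ℂ 2 vol)
  have h2 := Measure.eqOn_Icc_of_ae_eq volume Real.pi_pos.ne h
    (ext_continuous F).continuousOn continuousOn_const
  ext x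
  rw [← ext_coe]
  exact h2 x.2

lemma ae_zero_of_primitive_zero {g : ℝ → ℂ} (hi : IntervalIntegrable g volume 0 Real.pi)
    (h : IsPrimitive 0 g) : g =ᵐ[vol] 0 := by
  rw [EventuallyEq, ae_restrict_iff' measurableSet_Ioo]
  filter_upwards [hi.ae_hasDerivAt_integral] with x hx hm
  rw [uIcc_of_le Real.pi_pos.le] at hx
  have hd := hx ⟨hm.1.le, hm.2.le⟩ 0 ⟨le_rfl, Real.pi_pos.le⟩
  have he : (fun x => ∫ t in (0 : ℝ)..x, g t) =ᶠ[𝓝 x] fun _ => (0 : ℂ) := by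
    filter_upwards [Ioo_mem_nhds hm.1 hm.2] with s hs
    have := h ⟨s, hs.1.le, hs.2.le⟩
    simpa using this.symm
  exact (hd.congr_of_eventuallyEq he.symm).unique (hasDerivAt_const x (0 : ℂ))

lemma h1_eq_zero {f : H1} (h : h1val f = 0) : f = 0 := by
  obtain ⟨⟨a, a'⟩, ha⟩ := f
  change a = 0 at h
  subst h
  have : a' = 0 := Lp.ext ((ae_zero_of_primitive_zero (L2_intervalIntegrable a' right) ha).trans
    (Lp.coeFn_zero ℂ 2 vol).symm)
  subst this
  rfl

lemma h2_eq_zero {f : H2} (h : h2val f = 0) : f = 0 := by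
  obtain ⟨⟨a, a', a''⟩, ha⟩ := f
  change a = 0 at h
  subst h
  have h0 : a' = 0 := by
    apply toL2_injective
    rw [map_zero]
    refine Lp.ext ((toL2_coe a').trans ?_)
    exact (ae_zero_of_primitive_zero ((ext_continuous a').intervalIntegrable _ _) ha.1).trans
      (Lp.coeFn_zero ℂ 2 vol).symm
  subst h0
  have : (⟨(0, a''), ha.2⟩ : H1) = 0 := h1_eq_zero rfl
  have h1 : a'' = 0 := congrArg (fun f : H1 => f.1.2) this
  subst h1
  rfl

/-- `opGraph` is the graph of a (single valued) operator, so `op` is that operator. -/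
lemma op_graph : op.graph = opGraph := by
  refine Submodule.toLinearPMap_graph_eq _ ?_
  rintro ⟨y, z⟩ ⟨a, b, p, q, c, d, e, f, -, -⟩ hy
  change y = 0 at hy
  subst hy
  have hp : p = 0 := h1_eq_zero (toL2_injective (c.trans (map_zero toL2).symm))
  have hq : q = 0 := h2_eq_zero (toL2_injective (e.trans (map_zero toL2).symm))
  have h1 : z.u1 = 0 := h1_eq_zero (toL2_injective (a.trans (map_zero toL2).symm))
  have h2 : z.u2 = 0 := h2_eq_zero (toL2_injective (b.trans (map_zero toL2).symm))
  have h3 : z.v1 = 0 := d.trans (by rw [hp]; rfl)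
  have h4 : z.v2 = 0 := f.trans (by rw [hq]; exact neg_zero)
  exact Prod.ext (Subtype.ext (Prod.ext (congrArg Subtype.val h1) (congrArg Subtype.val h2)))
    (Prod.ext h3 h4)

/-! ## The frequencies and the forcing terms -/

/-- The positive integers `n` such that `√n` is an even integer. -/
def indexSet : Set ℕ := {n | 0 < n ∧ ∃ m : ℕ, Even m ∧ n = m ^ 2}

/-- `n → ∞` along `indexSet`. -/
def indexFilter : Filter ℕ := atTop ⊓ 𝓟 indexSet

/-- `β_n = n² + 2√n + 1/n`. -/
def beta (n : ℕ) : ℝ := (n : ℝ) ^ 2 + 2 * √(n : ℝ) + 1 / (n : ℝ)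

/-- The function `x ↦ sin(βx)` on `[0, π]`. -/
def sinFun (β : ℝ) : Cont := ⟨fun x => ((Real.sin (β * x) : ℝ) : ℂ), by fun_prop⟩

/-- `f_n = (0, 0, -sin(β_n x), 0)`. -/
def forcing (n : ℕ) : EnergySpace := ((0 : V), -toL2 (sinFun (beta n)), (0 : L2))

end

end StringBeam

/-!
The proof has three parts.

*Generation.* A maximal dissipative operator on a Hilbert space generates a contraction semigroup
(`IsMaxDissipative.hasGenerator_semigroup`), the limit of the exponentials of its Yosida
approximations, and no other semigroup (`C0Semigroup.HasGenerator.unique`), because the norm of a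
difference of two orbits cannot increase. For the string-beam operator, integration by parts gives
`Re ⟪y, 𝒜 y⟫ = -|v²(π)|²` (`StringBeam.re_inner_of_mem_graph`).

*Range.* For every `k`, if `k - 𝒜` is injective then it is onto
(`StringBeam.surjective_of_injective`). Indeed the Cauchy problems for `u'' = k² u + g₁` and
`v'''' = -k² v + g₂` are solvable, by factoring the operators into first order ones, so
that the resolvent equation becomes a linear system of six boundary conditions in six unknown initial
data. Dissipativity gives injectivity for `k > 0`. On the imaginary axis `v²(π) = 0` for an
eigenvector, and then Green's identity for the beam against `cos`, `sin`, `cosh`, `sinh` makes all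
Cauchy data vanish at `0` (`StringBeam.injective_imaginary`).

*Growth.* Write `β = α²`, `P = ∂ₓu¹(0) = ∂ₓ³u²(0)` for the force and `b = u¹(0)` for the displacement
at the joint. With `n = m²` one has `α = m² + 1/m`, so `sin (α π) = sin (π / m)` and
`sin (β π) = sin (π / m²)`. The four Green identities of the beam determine `b` by `P`; since
`sin (α π)` is only of size `1/m` they give `β |b| ≤ (3 / (2 m)) |P|` (`StringBeam.norm_joint_le`).
Green's identity for the string against `sin (β (π - x))` reads
`P sin (β π) + β b cos (β π) = ∫ sin (β x) sin (β (π - x)) dx`, whose right side is close to `-π / 2`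
and whose left side is at most `(7 / (2 m)) |P|`. Hence `|P| ≥ m / 8`
(`StringBeam.le_norm_of_relation`), while `|P|` is bounded by the energy norm of the solution, up to
constants (`StringBeam.norm_tension_le`). So the solutions, and with them the resolvents, are
unbounded. An exponentially stable semigroup would have a resolvent that is bounded on the imaginary
axis (`C0Semigroup.ExponentiallyStable.exists_norm_le`).
-/

/-! ### Maximal dissipative operators -/

section Semigroups

variable {H : Type*} [NormedAddCommGroup H] [InnerProductSpace ℂ H]

/-- `A` is maximal dissipative: `Re ⟪x, A x⟫ ≤ 0` on the domain, and `r - A` is onto for every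
real `r > 0`. -/
structure IsMaxDissipative (A : H →ₗ.[ℂ] H) : Prop where
  dissipative : ∀ {x y : H}, (x, y) ∈ A.graph → (inner ℂ x y).re ≤ 0
  surjective : ∀ r : ℝ, 0 < r → ∀ f : H, ∃ x y, (x, y) ∈ A.graph ∧ (r : ℂ) • x - y = f

namespace IsMaxDissipative

variable {A : H →ₗ.[ℂ] H}

lemma norm_le (hA : IsMaxDissipative A) {r : ℝ} {x y : H} (hxy : (x, y) ∈ A.graph) :
    r * ‖x‖ ≤ ‖(r : ℂ) • x - y‖ := by
  have h1 : (inner ℂ x ((r : ℂ) • x - y)).re = r * ‖x‖ ^ 2 - (inner ℂ x y).re := by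
    rw [inner_sub_right, inner_smul_right, inner_self_eq_norm_sq_to_K, Complex.sub_re,
      Complex.re_ofReal_mul]
    norm_cast
  have h2 : (inner ℂ x ((r : ℂ) • x - y)).re ≤ ‖x‖ * ‖(r : ℂ) • x - y‖ :=
    (Complex.re_le_norm _).trans (norm_inner_le_norm _ _)
  have h3 := hA.dissipative hxy
  rcases (norm_nonneg x).eq_or_lt' with h0 | h0
  · rw [h0, mul_zero]; positivity
  · refine le_of_mul_le_mul_left ?_ h0
    nlinarith

lemma eq_zero (hA : IsMaxDissipative A) {r : ℝ} (hr : 0 < r) {x y : H}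
    (hxy : (x, y) ∈ A.graph) (h : (r : ℂ) • x - y = 0) : x = 0 := by
  have := hA.norm_le (r := r) hxy
  rw [h, norm_zero] at this
  exact norm_le_zero_iff.1 (nonpos_of_mul_nonpos_right this hr)

lemma exists_resolvent (hA : IsMaxDissipative A) {r : ℝ} (hr : 0 < r) :
    ∃ J : H →L[ℂ] H, ‖J‖ ≤ r⁻¹ ∧ ∀ f, (J f, (r : ℂ) • J f - f) ∈ A.graph := by
  have h : ∀ f, ∃ x, (x, (r : ℂ) • x - f) ∈ A.graph := by
    intro f
    obtain ⟨x, y, hxy, rfl⟩ := hA.surjective r hr f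
    exact ⟨x, by simpa using hxy⟩
  choose J hJ using h
  have huniq : ∀ {x x' f : H}, (x, (r : ℂ) • x - f) ∈ A.graph →
      (x', (r : ℂ) • x' - f) ∈ A.graph → x = x' := by
    intro x x' f h1 h2
    have h3 := A.graph.sub_mem h1 h2
    refine sub_eq_zero.1 (hA.eq_zero hr h3 ?_)
    simp only [smul_sub]
    abel
  let L : H →ₗ[ℂ] H :=
    { toFun := J
      map_add' := fun f g => by
        refine huniq (hJ _) ?_
        convert A.graph.add_mem (hJ f) (hJ g) using 1
        refine Prod.ext rfl ?_
        simp only [smul_add, Prod.snd_add]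
        abel
      map_smul' := fun c f => by
        refine huniq (hJ _) ?_
        convert A.graph.smul_mem c (hJ f) using 1
        refine Prod.ext rfl ?_
        simp only [RingHom.id_apply, smul_sub, Prod.smul_snd, smul_comm c (r : ℂ)] }
  have hb : ∀ f, ‖L f‖ ≤ r⁻¹ * ‖f‖ := by
    intro f
    have := hA.norm_le (r := r) (hJ f)
    rw [sub_sub_cancel] at this
    rw [inv_mul_eq_div, le_div_iff₀' hr]
    exact this
  exact ⟨L.mkContinuous _ hb, L.mkContinuous_norm_le (inv_nonneg.2 hr.le) hb, hJ⟩

/-- The resolvent `(r - A)⁻¹` at a real point `r > 0`. -/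
noncomputable def res (hA : IsMaxDissipative A) {r : ℝ} (hr : 0 < r) : H →L[ℂ] H :=
  (hA.exists_resolvent hr).choose

variable (hA : IsMaxDissipative A) {r s : ℝ} (hr : 0 < r) (hs : 0 < s)

lemma norm_res_le : ‖hA.res hr‖ ≤ r⁻¹ := (hA.exists_resolvent hr).choose_spec.1

lemma res_mem (f : H) : (hA.res hr f, (r : ℂ) • hA.res hr f - f) ∈ A.graph :=
  (hA.exists_resolvent hr).choose_spec.2 f

lemma res_apply {x y : H} (hxy : (x, y) ∈ A.graph) : hA.res hr ((r : ℂ) • x - y) = x := by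
  refine sub_eq_zero.1 (hA.eq_zero hr (A.graph.sub_mem (hA.res_mem hr _) hxy) ?_)
  simp only [smul_sub]
  abel

lemma res_comm (f : H) : hA.res hr (hA.res hs f) = hA.res hs (hA.res hr f) := by
  have h1 := hA.res_apply hr (hA.res_mem hs f)
  have h2 := hA.res_apply hs (hA.res_mem hr (hA.res hs f))
  have h3 : (s : ℂ) • hA.res hr (hA.res hs f) - ((r : ℂ) • hA.res hr (hA.res hs f) - hA.res hs f)
      = hA.res hr f := by
    simp only [map_sub, map_smul] at h1
    linear_combination (norm := module) (-1 : ℂ) • h1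
  rw [h3] at h2
  exact h2.symm

/-- The domain is dense: a vector orthogonal to it is orthogonal to its own image under `(1 - A)⁻¹`,
which dissipativity forces to vanish. -/
lemma dense [CompleteSpace H] (hA : IsMaxDissipative A) : Dense (A.domain : Set H) := by
  rw [Submodule.dense_iff_topologicalClosure_eq_top, Submodule.topologicalClosure_eq_top_iff,
    Submodule.eq_bot_iff]
  intro z hz
  rw [Submodule.mem_orthogonal] at hz
  have h1 := hA.res_mem one_pos z
  have h2 := hz _ (LinearPMap.mem_domain_of_mem_graph h1)
  have h3 := hA.dissipative h1
  rw [inner_sub_right, h2, sub_zero, inner_smul_right, inner_self_eq_norm_sq_to_K] at h3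
  have h4 : ‖hA.res one_pos z‖ ^ 2 ≤ 0 := by
    rw [Complex.re_ofReal_mul, one_mul] at h3
    exact_mod_cast h3
  have h5 : hA.res one_pos z = 0 := by
    rw [← norm_eq_zero]
    exact pow_eq_zero_iff two_ne_zero |>.1 (le_antisymm h4 (by positivity))
  rw [h5, smul_zero, zero_sub] at h1
  have := LinearPMap.graph_fst_eq_zero_snd A h1 rfl
  exact neg_eq_zero.1 this

/-! ### The Yosida approximation -/

/-- The Yosida approximation `A_r = r (r (r - A)⁻¹ - 1)`, a bounded operator. -/
noncomputable def yosida : H →L[ℂ] H := (r : ℂ) • ((r : ℂ) • hA.res hr - 1)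

lemma yosida_eq {x y : H} (hxy : (x, y) ∈ A.graph) :
    hA.yosida hr x = (r : ℂ) • hA.res hr y := by
  have h := hA.res_apply hr hxy
  simp only [map_sub, map_smul] at h
  simp only [yosida, smul_apply, sub_apply,
    one_apply_eq_self]
  linear_combination (norm := module) (r : ℂ) • h

lemma yosida_comm : Commute (hA.yosida hr) (hA.yosida hs) := by
  have h : Commute (hA.res hr) (hA.res hs) := ContinuousLinearMap.ext fun f => hA.res_comm hr hs f
  exact ((((h.smul_left _).smul_right _).sub_left (Commute.one_left _)).sub_right
    (Commute.one_right _)).smul_left _ |>.smul_right _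

lemma norm_smul_res_le (f : H) : ‖(r : ℂ) • hA.res hr f‖ ≤ ‖f‖ := by
  rw [norm_smul, Complex.norm_real, Real.norm_of_nonneg hr.le]
  calc r * ‖hA.res hr f‖ ≤ r * (r⁻¹ * ‖f‖) := by
        gcongr
        exact (hA.res hr).le_of_opNorm_le (hA.norm_res_le hr) f
    _ = ‖f‖ := by field_simp

lemma yosida_dissipative (x : H) : (inner ℂ x (hA.yosida hr x)).re ≤ 0 := by
  have h1 : (inner ℂ x ((r : ℂ) • hA.res hr x)).re ≤ ‖x‖ ^ 2 := by
    refine (Complex.re_le_norm _).trans ((norm_inner_le_norm _ _).trans ?_)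
    rw [sq]
    gcongr
    exact hA.norm_smul_res_le hr x
  have h2 : (inner ℂ x (hA.yosida hr x)).re
      = r * ((inner ℂ x ((r : ℂ) • hA.res hr x)).re - ‖x‖ ^ 2) := by
    simp only [yosida, smul_apply, sub_apply,
      one_apply_eq_self]
    rw [inner_smul_right, inner_sub_right, Complex.re_ofReal_mul, Complex.sub_re,
      inner_self_eq_norm_sq_to_K]
    norm_cast
  rw [h2]
  nlinarith

lemma tendsto_smul_res [CompleteSpace H] (hA : IsMaxDissipative A) (x : H) :
    Tendsto (fun n : ℕ => ((n + 1 : ℝ) : ℂ) • hA.res n.cast_add_one_pos x) atTop (𝓝 x) := by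
  rw [Metric.tendsto_atTop]
  intro ε hε
  obtain ⟨z, hz, hxz⟩ := hA.dense.exists_dist_lt x (ε := ε / 3) (by positivity)
  obtain ⟨w, hw⟩ := LinearPMap.mem_domain_iff.1 hz
  obtain ⟨N, hN⟩ := exists_nat_gt (‖w‖ / (ε / 3))
  refine ⟨N, fun n hn => ?_⟩
  have hpos : (0 : ℝ) < n + 1 := n.cast_add_one_pos
  set J := hA.res hpos with hJ
  have h1 : ((n + 1 : ℝ) : ℂ) • J z - z = J w := by
    have h := hA.res_apply hpos hw
    simp only [map_sub, map_smul] at h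
    linear_combination (norm := module) h
  have h2 : ‖J w‖ < ε / 3 := by
    refine ((J.le_of_opNorm_le (hA.norm_res_le hpos) w)).trans_lt ?_
    rw [inv_mul_eq_div, div_lt_iff₀ hpos]
    rw [div_lt_iff₀ (by positivity)] at hN
    have : (N : ℝ) ≤ n := by exact_mod_cast hn
    nlinarith
  have h3 : ‖((n + 1 : ℝ) : ℂ) • J (x - z)‖ ≤ ‖x - z‖ := hA.norm_smul_res_le hpos (x - z)
  rw [dist_eq_norm] at hxz ⊢
  have h4 : ((n + 1 : ℝ) : ℂ) • J x - x
      = ((n + 1 : ℝ) : ℂ) • J (x - z) + J w - (x - z) := by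
    rw [← h1, map_sub, smul_sub]
    abel
  rw [h4]
  calc _ ≤ ‖((n + 1 : ℝ) : ℂ) • J (x - z)‖ + ‖J w‖ + ‖x - z‖ :=
        (norm_sub_le _ _).trans (add_le_add_left (norm_add_le _ _) _)
    _ < ε := by linarith

end IsMaxDissipative

/-! ### Energy estimates for evolution equations -/

/-- If `u` solves a dissipative evolution equation (with right derivatives), `‖u‖` decreases. -/
lemma norm_le_of_dissipative {u u' : ℝ → H} (hu : Continuous u)
    (hd : ∀ t, 0 ≤ t → HasDerivWithinAt u (u' t) (Ici t) t)
    (h : ∀ t, 0 ≤ t → (inner ℂ (u t) (u' t)).re ≤ 0) {t : ℝ} (ht : 0 ≤ t) : ‖u t‖ ≤ ‖u 0‖ := by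
  let _ : InnerProductSpace ℝ H := InnerProductSpace.rclikeToReal ℂ H
  have h1 := image_le_of_deriv_right_le_deriv_boundary (f := fun s => ‖u s‖ ^ 2)
    (B := fun _ => ‖u 0‖ ^ 2) (B' := fun _ => 0) (a := 0) (b := t)
    (by fun_prop) (fun s hs => (hd s hs.1).norm_sq) le_rfl continuousOn_const
    (fun s _ => hasDerivWithinAt_const _ _ _) (fun s hs => ?_) ⟨ht, le_rfl⟩
  · exact (pow_le_pow_iff_left₀ (norm_nonneg _) (norm_nonneg _) two_ne_zero).1 h1
  · have := h s hs.1
    rw [real_inner_eq_re_inner ℂ]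
    simp only [RCLike.re_to_complex]
    linarith

section Exp

variable [CompleteSpace H] {B C : H →L[ℂ] H}

open NormedSpace in
lemma hasDerivAt_exp_apply (B : H →L[ℂ] H) (x : H) (t : ℝ) :
    HasDerivAt (fun s : ℝ => exp (s • B) x) (exp (t • B) (B x)) t := by
  have h := hasDerivAt_exp_smul_const B t
  have h2 := (ContinuousLinearMap.apply ℂ H x).restrictScalars ℝ |>.hasFDerivAt.comp_hasDerivAt t h
  exact h2

open NormedSpace in
lemma norm_exp_smul_apply_le (hB : ∀ x, (inner ℂ x (B x)).re ≤ 0) {t : ℝ} (ht : 0 ≤ t) (x : H) :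
    ‖exp (t • B) x‖ ≤ ‖x‖ := by
  have hc : ∀ s : ℝ, exp (s • B) (B x) = B (exp (s • B) x) := fun s =>
    DFunLike.congr_fun (((Commute.refl B).smul_left s).exp_left).eq x
  have h := norm_le_of_dissipative (u := fun s : ℝ => exp (s • B) x)
    (continuous_iff_continuousAt.2 fun s => (hasDerivAt_exp_apply B x s).continuousAt)
    (fun s _ => (hasDerivAt_exp_apply B x s).hasDerivWithinAt)
    (fun s _ => by rw [hc]; exact hB _) ht
  simpa using h

open NormedSpace in
/-- Two commuting generators of contractions: the difference of the exponentials is the integral of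
the derivative of `s ↦ exp (s B) exp ((t - s) C) x`. -/
lemma norm_exp_sub_exp_le (hBC : Commute B C) (hB : ∀ x, (inner ℂ x (B x)).re ≤ 0)
    (hC : ∀ x, (inner ℂ x (C x)).re ≤ 0) {t : ℝ} (ht : 0 ≤ t) (x : H) :
    ‖exp (t • B) x - exp (t • C) x‖ ≤ t * ‖B x - C x‖ := by
  have hd : ∀ s : ℝ, HasDerivAt (fun s : ℝ => exp (s • B) (exp ((t - s) • C) x))
      (exp (s • B) (exp ((t - s) • C) (B x - C x))) s := by
    intro s
    have h1 := hasDerivAt_exp_smul_const B s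
    have h2 : HasDerivAt (fun s : ℝ => exp ((t - s) • C) x) (-(exp ((t - s) • C) (C x))) s := by
      have := (hasDerivAt_exp_apply C x (t - s)).scomp s ((hasDerivAt_id s).const_sub t)
      simpa [Function.comp_def] using this
    have h3 := ((ContinuousLinearMap.restrictScalarsL ℂ H H ℝ ℝ).hasFDerivAt.comp_hasDerivAt s
      h1).clm_apply h2
    refine h3.congr_deriv ?_
    have hc : exp ((t - s) • C) (B x) = B (exp ((t - s) • C) x) :=
      DFunLike.congr_fun ((hBC.symm.smul_left (t - s)).exp_left).eq x
    simp only [map_sub, hc, map_neg]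
    exact (sub_eq_add_neg _ _).symm
  have h := norm_image_sub_le_of_norm_deriv_le_segment' (a := 0) (b := t) (C := ‖B x - C x‖)
    (fun s _ => (hd s).hasDerivWithinAt) (fun s hs => ?_) t ⟨ht, le_rfl⟩
  · simpa [mul_comm] using h
  · exact (norm_exp_smul_apply_le hB hs.1 _).trans
      (norm_exp_smul_apply_le hC (sub_nonneg.2 hs.2.le) _)

open NormedSpace in
lemma norm_exp_smul_sub_le (hB : ∀ x, (inner ℂ x (B x)).re ≤ 0) {t : ℝ} (ht : 0 ≤ t) (x : H) :
    ‖exp (t • B) x - x‖ ≤ t * ‖B x‖ := by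
  have h := norm_exp_sub_exp_le (C := 0) (Commute.zero_right B) hB (by simp) ht x
  simpa using h

open NormedSpace in
/-- First order expansion of the exponential, with a remainder that depends on `B` only through
its values at two vectors. -/
lemma norm_exp_smul_sub_sub_le (hB : ∀ x, (inner ℂ x (B x)).re ≤ 0) {t : ℝ} (ht : 0 ≤ t)
    (x z : H) :
    ‖exp (t • B) x - x - t • B x‖ ≤ (2 * ‖B x - z‖ + t * ‖B z‖) * t := by
  have hd : ∀ s : ℝ, HasDerivAt (fun s : ℝ => exp (s • B) x - s • B x)
      (exp (s • B) (B x) - B x) s := fun s => by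
    simpa only [id, one_smul] using
      (hasDerivAt_exp_apply B x s).fun_sub ((hasDerivAt_id s).smul_const (B x))
  have h := norm_image_sub_le_of_norm_deriv_le_segment' (a := 0) (b := t)
    (C := 2 * ‖B x - z‖ + t * ‖B z‖)
    (fun s _ => (hd s).hasDerivWithinAt) (fun s hs => ?_) t ⟨ht, le_rfl⟩
  · have e : exp (t • B) x - x - t • B x = exp (t • B) x - t • B x
        - (exp ((0 : ℝ) • B) x - (0 : ℝ) • B x) := by
      simp only [zero_smul, exp_zero, one_apply_eq_self, sub_zero]
      abel
    rw [e]
    simpa using h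
  · have e : exp (s • B) (B x) - B x
        = exp (s • B) (B x - z) + (exp (s • B) z - z) - (B x - z) := by
      rw [map_sub]
      abel
    rw [e]
    have h1 := norm_exp_smul_apply_le hB hs.1 (B x - z)
    have h2 := norm_exp_smul_sub_le hB hs.1 z
    have h3 : s * ‖B z‖ ≤ t * ‖B z‖ := by
      gcongr
      exact hs.2.le
    calc _ ≤ ‖exp (s • B) (B x - z)‖ + ‖exp (s • B) z - z‖ + ‖B x - z‖ :=
          (norm_sub_le _ _).trans (add_le_add_left (norm_add_le _ _) _)
      _ ≤ _ := by linarith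

end Exp

end Semigroups

/-! ### Generation of contraction semigroups -/

section Generation

variable {H : Type*} [NormedAddCommGroup H] [InnerProductSpace ℂ H]

namespace IsMaxDissipative

variable {A : H →ₗ.[ℂ] H} (hA : IsMaxDissipative A)

/-- The Yosida approximation with parameter `n + 1`. -/
noncomputable def approx (n : ℕ) : H →L[ℂ] H := hA.yosida n.cast_add_one_pos

lemma approx_dissipative (n : ℕ) (x : H) : (inner ℂ x (hA.approx n x)).re ≤ 0 :=
  hA.yosida_dissipative _ x

variable [CompleteSpace H]

lemma tendsto_approx {x y : H} (hxy : (x, y) ∈ A.graph) :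
    Tendsto (fun n => hA.approx n x) atTop (𝓝 y) := by
  simp only [approx, hA.yosida_eq _ hxy]
  exact hA.tendsto_smul_res y

open NormedSpace in
lemma cauchySeq_exp_approx (t : ℝ≥0) (x : H) :
    CauchySeq fun n => exp ((t : ℝ) • hA.approx n) x := by
  rw [Metric.cauchySeq_iff]
  intro ε hε
  obtain ⟨z, hz, hxz⟩ := hA.dense.exists_dist_lt x (ε := ε / 3) (by positivity)
  obtain ⟨w, hw⟩ := LinearPMap.mem_domain_iff.1 hz
  have h1 := (hA.tendsto_approx hw).cauchySeq
  rw [Metric.cauchySeq_iff] at h1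
  obtain ⟨N, hN⟩ := h1 (ε / 3 / (t + 1)) (by positivity)
  refine ⟨N, fun m hm n hn => ?_⟩
  have h2 := hN m hm n hn
  rw [dist_eq_norm] at h2 hxz ⊢
  rw [lt_div_iff₀ (by positivity)] at h2
  have h3 := norm_exp_sub_exp_le (hA.yosida_comm m.cast_add_one_pos n.cast_add_one_pos)
    (hA.approx_dissipative m) (hA.approx_dissipative n) t.2 z
  change ‖exp ((t : ℝ) • hA.approx m) z - exp ((t : ℝ) • hA.approx n) z‖
    ≤ t * ‖hA.approx m z - hA.approx n z‖ at h3
  have h4 := norm_exp_smul_apply_le (hA.approx_dissipative m) t.2 (x - z)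
  have h5 := norm_exp_smul_apply_le (hA.approx_dissipative n) t.2 (x - z)
  have e : exp ((t : ℝ) • hA.approx m) x - exp ((t : ℝ) • hA.approx n) x
      = exp ((t : ℝ) • hA.approx m) (x - z)
        + (exp ((t : ℝ) • hA.approx m) z - exp ((t : ℝ) • hA.approx n) z)
        - exp ((t : ℝ) • hA.approx n) (x - z) := by
    simp only [map_sub]
    abel
  rw [e]
  have h6 := norm_nonneg (hA.approx m z - hA.approx n z)
  calc _ ≤ ‖exp ((t : ℝ) • hA.approx m) (x - z)‖
        + ‖exp ((t : ℝ) • hA.approx m) z - exp ((t : ℝ) • hA.approx n) z‖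
        + ‖exp ((t : ℝ) • hA.approx n) (x - z)‖ :=
        (norm_sub_le _ _).trans (add_le_add_left (norm_add_le _ _) _)
    _ ≤ ‖x - z‖ + t * ‖hA.approx m z - hA.approx n z‖ + ‖x - z‖ := by gcongr <;> assumption
    _ < ε := by nlinarith

open NormedSpace in
lemma tendsto_exp_approx (t : ℝ≥0) :
    Tendsto (fun n x => exp ((t : ℝ) • hA.approx n) x) atTop
      (𝓝 fun x => (cauchySeq_tendsto_of_complete (hA.cauchySeq_exp_approx t x)).choose) :=
  tendsto_pi_nhds.2 fun x =>
    (cauchySeq_tendsto_of_complete (hA.cauchySeq_exp_approx t x)).choose_spec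

open NormedSpace in
/-- The operators `T(t) x = lim exp (t Aₙ) x`, where `Aₙ` are the Yosida approximations. -/
noncomputable def flow (t : ℝ≥0) : H →L[ℂ] H :=
  continuousLinearMapOfTendsto (fun n => exp ((t : ℝ) • hA.approx n)) (hA.tendsto_exp_approx t)

open NormedSpace in
lemma tendsto_flow (t : ℝ≥0) (x : H) :
    Tendsto (fun n => exp ((t : ℝ) • hA.approx n) x) atTop (𝓝 (hA.flow t x)) :=
  tendsto_pi_nhds.1 (hA.tendsto_exp_approx t) x

lemma norm_flow_le (t : ℝ≥0) (x : H) : ‖hA.flow t x‖ ≤ ‖x‖ :=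
  le_of_tendsto (hA.tendsto_flow t x).norm
    (Eventually.of_forall fun n => norm_exp_smul_apply_le (hA.approx_dissipative n) t.2 x)

lemma flow_zero : hA.flow 0 = ContinuousLinearMap.id ℂ H := by
  ext x
  refine tendsto_nhds_unique (hA.tendsto_flow 0 x) ?_
  simp

open NormedSpace in
lemma flow_add (s t : ℝ≥0) : hA.flow (s + t) = (hA.flow s).comp (hA.flow t) := by
  ext x
  refine tendsto_nhds_unique (hA.tendsto_flow (s + t) x) ?_
  have h1 : ∀ n, exp (((s + t : ℝ≥0) : ℝ) • hA.approx n) x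
      = exp ((s : ℝ) • hA.approx n) (exp ((t : ℝ) • hA.approx n) x) := by
    intro n
    let _ : NormedAlgebra ℚ (H →L[ℂ] H) := NormedAlgebra.restrictScalars ℚ ℂ _
    rw [NNReal.coe_add, add_smul,
      exp_add_of_commute (((Commute.refl (hA.approx n)).smul_left _).smul_right _)]
    rfl
  simp only [h1]
  have h2 : Tendsto (fun n => exp ((s : ℝ) • hA.approx n)
      (exp ((t : ℝ) • hA.approx n) x - hA.flow t x)) atTop (𝓝 0) := by
    refine squeeze_zero_norm
      (fun n => norm_exp_smul_apply_le (hA.approx_dissipative n) s.2 _) ?_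
    have := ((hA.tendsto_flow t x).sub_const (hA.flow t x)).norm
    simpa using this
  have h3 := h2.add (hA.tendsto_flow s (hA.flow t x))
  simp only [map_sub, sub_add_cancel, zero_add] at h3
  exact h3

lemma norm_flow_sub_le {x y : H} (hxy : (x, y) ∈ A.graph) (t : ℝ≥0) :
    ‖hA.flow t x - x‖ ≤ t * ‖y‖ :=
  le_of_tendsto_of_tendsto ((hA.tendsto_flow t x).sub_const x).norm
    ((hA.tendsto_approx hxy).norm.const_mul _)
    (Eventually.of_forall fun n => norm_exp_smul_sub_le (hA.approx_dissipative n) t.2 x)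

lemma continuous_flow (x : H) : Continuous fun t => hA.flow t x := by
  have h1 : ∀ z ∈ A.domain, Continuous fun t => hA.flow t z := by
    intro z hz
    obtain ⟨w, hw⟩ := LinearPMap.mem_domain_iff.1 hz
    have h2 : ∀ s t : ℝ≥0, s ≤ t → dist (hA.flow t z) (hA.flow s z) ≤ ‖w‖ * dist t s := by
      intro s t hst
      obtain ⟨h, rfl⟩ := exists_add_of_le hst
      rw [flow_add, dist_eq_norm, ContinuousLinearMap.comp_apply, ← map_sub]
      refine (hA.norm_flow_le s _).trans ((hA.norm_flow_sub_le hw h).trans ?_)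
      rw [NNReal.dist_eq, NNReal.coe_add, add_sub_cancel_left, abs_of_nonneg (NNReal.coe_nonneg h),
        mul_comm]
    refine (LipschitzWith.of_dist_le_mul (K := ‖w‖₊) fun t s => ?_).continuous
    rcases le_total s t with h | h
    · exact h2 s t h
    · rw [dist_comm, dist_comm t]
      exact h2 t s h
  refine continuous_of_uniform_approx_of_continuous fun u hu => ?_
  obtain ⟨ε, hε, hεu⟩ := Metric.mem_uniformity_dist.1 hu
  obtain ⟨z, hz, hxz⟩ := hA.dense.exists_dist_lt x hε
  refine ⟨fun t => hA.flow t z, h1 z hz, fun t => hεu ?_⟩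
  rw [dist_eq_norm] at hxz ⊢
  rw [← map_sub]
  exact (hA.norm_flow_le t _).trans_lt hxz

/-- The contraction semigroup generated by a maximal dissipative operator. -/
noncomputable def semigroup : C0Semigroup H where
  op := hA.flow
  op_zero := hA.flow_zero
  op_add := hA.flow_add
  continuous_orbit := hA.continuous_flow

lemma tendsto_flow_of_mem {x y : H} (hxy : (x, y) ∈ A.graph) :
    Tendsto (fun t : ℝ≥0 => (((t : ℝ) : ℂ))⁻¹ • (hA.flow t x - x)) (𝓝[>] 0) (𝓝 y) := by
  rw [Metric.tendsto_nhds]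
  intro ε hε
  obtain ⟨z, hz, hyz⟩ := hA.dense.exists_dist_lt y (ε := ε / 4) (by positivity)
  obtain ⟨w, hw⟩ := LinearPMap.mem_domain_iff.1 hz
  have h1 : ∀ t : ℝ≥0, ‖hA.flow t x - x - (t : ℝ) • y‖ ≤ (2 * ‖y - z‖ + t * ‖w‖) * t := by
    intro t
    refine le_of_tendsto_of_tendsto (((hA.tendsto_flow t x).sub_const x).sub
      ((hA.tendsto_approx hxy).const_smul (t : ℝ))).norm
      ((((hA.tendsto_approx hxy).sub_const z).norm.const_mul 2).add
        ((hA.tendsto_approx hw).norm.const_mul (t : ℝ)) |>.mul_const (t : ℝ)) ?_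
    exact Eventually.of_forall fun n =>
      norm_exp_smul_sub_sub_le (hA.approx_dissipative n) t.2 x z
  have h2 : ∀ᶠ t : ℝ≥0 in 𝓝[>] 0, (t : ℝ) * ‖w‖ < ε / 2 := by
    refine nhdsWithin_le_nhds ?_
    have : Tendsto (fun t : ℝ≥0 => (t : ℝ) * ‖w‖) (𝓝 0) (𝓝 (((0 : ℝ≥0) : ℝ) * ‖w‖)) :=
      (by fun_prop : Continuous fun t : ℝ≥0 => (t : ℝ) * ‖w‖).tendsto 0
    refine this.eventually_lt_const ?_
    simpa using hε
  filter_upwards [h2, self_mem_nhdsWithin] with t ht hpos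
  have hpos' : (0 : ℝ) < t := hpos
  have e : (((t : ℝ) : ℂ))⁻¹ • (hA.flow t x - x) - y
      = (((t : ℝ) : ℂ))⁻¹ • (hA.flow t x - x - (t : ℝ) • y) := by
    rw [smul_sub _ (hA.flow t x - x), ← Complex.coe_smul (t : ℝ) y, smul_smul,
      inv_mul_cancel₀ (by exact_mod_cast hpos'.ne'), one_smul]
  rw [dist_eq_norm] at hyz ⊢
  rw [e, norm_smul, norm_inv, Complex.norm_real, Real.norm_of_nonneg hpos'.le, inv_mul_eq_div,
    div_lt_iff₀ hpos']
  refine (h1 t).trans_lt ?_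
  gcongr
  linarith

lemma hasGenerator_semigroup : hA.semigroup.HasGenerator A := by
  intro x y
  refine ⟨hA.tendsto_flow_of_mem, fun h => ?_⟩
  -- the generator is a dissipative extension of `A`, hence equal to it
  have hd : ∀ {x y : H}, Tendsto (fun t : ℝ≥0 => (((t : ℝ) : ℂ))⁻¹ • (hA.flow t x - x))
      (𝓝[>] 0) (𝓝 y) → (inner ℂ x y).re ≤ 0 := by
    intro x y h
    refine le_of_tendsto ((Complex.continuous_re.tendsto _).comp (tendsto_const_nhds.inner h)) ?_
    refine Eventually.of_forall fun t => ?_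
    simp only [Function.comp_apply]
    rw [inner_smul_right, ← Complex.ofReal_inv, Complex.re_ofReal_mul]
    refine mul_nonpos_of_nonneg_of_nonpos (by positivity) ?_
    rw [inner_sub_right, Complex.sub_re, inner_self_eq_norm_sq_to_K]
    have h1 : (inner ℂ x (hA.flow t x)).re ≤ ‖x‖ ^ 2 := by
      refine (Complex.re_le_norm _).trans ((norm_inner_le_norm _ _).trans ?_)
      rw [sq]
      gcongr
      exact hA.norm_flow_le t x
    have h2 : ((((‖x‖ : ℝ) : ℂ)) ^ 2).re = ‖x‖ ^ 2 := by norm_cast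
    exact sub_nonpos.2 (h1.trans h2.ge)
  obtain ⟨w, w', hw, he⟩ := hA.surjective 1 one_pos (x - y)
  rw [Complex.ofReal_one, one_smul] at he
  have h2 : Tendsto (fun t : ℝ≥0 => (((t : ℝ) : ℂ))⁻¹ • (hA.flow t (x - w) - (x - w)))
      (𝓝[>] 0) (𝓝 (y - w')) := by
    refine (h.sub (hA.tendsto_flow_of_mem hw)).congr fun t => ?_
    rw [map_sub, ← smul_sub]
    congr 1
    simp only [semigroup]
    abel
  have h3 : y - w' = x - w := by
    rw [← sub_eq_zero] at he ⊢
    rw [← he]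
    abel
  have h4 := hd h2
  rw [h3, inner_self_eq_norm_sq_to_K] at h4
  have h5 : ‖x - w‖ ^ 2 ≤ 0 := by exact_mod_cast h4
  have h6 : x - w = 0 := by
    rw [← norm_eq_zero]
    exact pow_eq_zero_iff two_ne_zero |>.1 (le_antisymm h5 (by positivity))
  rw [h6, sub_eq_zero] at h3
  rw [sub_eq_zero.1 h6, h3]
  exact hw

end IsMaxDissipative

end Generation

/-! ### Orbits of a semigroup with a given generator -/

lemma tendsto_toNNReal_sub (t : ℝ) :
    Tendsto (fun s : ℝ => (s - t).toNNReal) (𝓝[>] t) (𝓝[>] 0) := by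
  refine tendsto_nhdsWithin_iff.2 ⟨?_, ?_⟩
  · have : Tendsto (fun s : ℝ => (s - t).toNNReal) (𝓝 t) (𝓝 (t - t).toNNReal) :=
      (by fun_prop : Continuous fun s : ℝ => (s - t).toNNReal).tendsto t
    rw [sub_self, Real.toNNReal_zero] at this
    exact this.mono_left nhdsWithin_le_nhds
  · filter_upwards [self_mem_nhdsWithin] with s hs
    exact Real.toNNReal_pos.2 (sub_pos.2 hs)

namespace C0Semigroup

section Orbits

variable {H : Type*} [NormedAddCommGroup H] [NormedSpace ℂ H] {T : C0Semigroup H}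
  {A : H →ₗ.[ℂ] H}

lemma HasGenerator.apply_mem_graph (hT : T.HasGenerator A) {x y : H} (hxy : (x, y) ∈ A.graph)
    (t : ℝ≥0) : (T.op t x, T.op t y) ∈ A.graph := by
  rw [hT]
  refine (((T.op t).continuous.tendsto y).comp ((hT x y).1 hxy)).congr fun h => ?_
  have e : T.op h (T.op t x) = T.op t (T.op h x) := by
    rw [← ContinuousLinearMap.comp_apply, ← T.op_add, add_comm, T.op_add]
    rfl
  rw [Function.comp_apply, map_smul, map_sub, e]

lemma HasGenerator.hasDerivWithinAt (hT : T.HasGenerator A) {x y : H} (hxy : (x, y) ∈ A.graph)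
    {t : ℝ} (ht : 0 ≤ t) :
    HasDerivWithinAt (fun s : ℝ => T.op s.toNNReal x) (T.op t.toNNReal y) (Ici t) t := by
  rw [← hasDerivWithinAt_Ioi_iff_Ici, hasDerivWithinAt_iff_tendsto_slope' self_notMem_Ioi]
  refine (((hT _ _).1 (hT.apply_mem_graph hxy t.toNNReal)).comp
    (tendsto_toNNReal_sub t)).congr' ?_
  filter_upwards [self_mem_nhdsWithin] with s hs
  have hst : 0 ≤ s - t := sub_nonneg.2 (le_of_lt hs)
  have e : T.op s.toNNReal x = T.op (s - t).toNNReal (T.op t.toNNReal x) := by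
    rw [← ContinuousLinearMap.comp_apply, ← T.op_add, ← Real.toNNReal_add hst ht, sub_add_cancel]
  rw [Function.comp_apply, slope_def_module, e, Real.coe_toNNReal _ hst, ← Complex.ofReal_inv,
    Complex.coe_smul]

lemma continuous_orbit_real (T : C0Semigroup H) (x : H) :
    Continuous fun s : ℝ => T.op s.toNNReal x :=
  (T.continuous_orbit x).comp continuous_real_toNNReal

/-- For an exponentially stable semigroup the resolvent is bounded on the imaginary axis, because
`y` is recovered from `(iβ - A) y` by integrating along the orbit. -/
lemma ExponentiallyStable.exists_norm_le (hT : T.HasGenerator A) (hs : T.ExponentiallyStable) :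
    ∃ K : ℝ, 0 ≤ K ∧ ∀ (b : ℝ) {x y : H}, (x, y) ∈ A.graph →
      ‖x‖ ≤ K * ‖y - (Complex.I * b) • x‖ := by
  obtain ⟨M, w, hw, hM⟩ := hs
  have hM0 : 0 ≤ M := by
    have := (norm_nonneg _).trans (hM 0)
    simpa using this
  refine ⟨M / w, by positivity, fun b x y hxy => ?_⟩
  obtain ⟨f, hf⟩ : ∃ f, f = y - (Complex.I * b) • x := ⟨_, rfl⟩
  rw [← hf]
  have hd : ∀ t : ℝ, 0 ≤ t → HasDerivWithinAt
      (fun s : ℝ => Complex.exp (-(Complex.I * b) * s) • T.op s.toNNReal x - x)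
      (Complex.exp (-(Complex.I * b) * t) • T.op t.toNNReal f) (Ici t) t := by
    intro t ht
    have h1 : HasDerivAt (fun s : ℝ => Complex.exp (-(Complex.I * b) * s))
        (Complex.exp (-(Complex.I * b) * t) * -(Complex.I * b)) t := by
      have := ((hasDerivAt_id (t : ℂ)).const_mul (-(Complex.I * b))).cexp.comp_ofReal
      simpa using this
    refine ((h1.hasDerivWithinAt.fun_smul (hT.hasDerivWithinAt hxy ht)).sub_const x).congr_deriv ?_
    rw [hf, map_sub, map_smul, smul_sub, smul_smul, mul_neg, neg_smul]
    abel
  have hn : ∀ s : ℝ, ‖Complex.exp (-(Complex.I * b) * s)‖ = 1 := by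
    intro s
    rw [Complex.norm_exp]
    simp
  have hB : ∀ t : ℝ, HasDerivAt (fun s : ℝ => M / w * ‖f‖ * (1 - Real.exp (-w * s)))
      (M * Real.exp (-w * t) * ‖f‖) t := by
    intro t
    have := (((hasDerivAt_id t).const_mul (-w)).exp.const_sub 1).const_mul (M / w * ‖f‖)
    refine this.congr_deriv ?_
    simp only [id, mul_one]
    field_simp
  have hle : ∀ {s : ℝ}, 0 ≤ s → ∀ v : H, ‖T.op s.toNNReal v‖ ≤ M * Real.exp (-w * s) * ‖v‖ := by
    intro s hs v
    have h1 := hM s.toNNReal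
    rw [Real.coe_toNNReal _ hs] at h1
    exact (T.op s.toNNReal).le_of_opNorm_le h1 v
  have hcont : Continuous fun s : ℝ =>
      Complex.exp (-(Complex.I * b) * s) • T.op s.toNNReal x - x :=
    ((by fun_prop : Continuous fun s : ℝ => Complex.exp (-(Complex.I * b) * s)).smul
      (T.continuous_orbit_real x)).sub continuous_const
  have h0 : ‖Complex.exp (-(Complex.I * b) * (0 : ℝ)) • T.op (0 : ℝ).toNNReal x - x‖
      ≤ M / w * ‖f‖ * (1 - Real.exp (-w * 0)) := by
    rw [Real.toNNReal_zero, T.op_zero]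
    simp
  have hbound : ∀ t : ℝ, ∀ s ∈ Ico 0 t, ‖Complex.exp (-(Complex.I * b) * s) • T.op s.toNNReal f‖
      ≤ M * Real.exp (-w * s) * ‖f‖ := by
    intro t s hs
    rw [norm_smul, hn, one_mul]
    exact hle hs.1 f
  have key : ∀ t : ℝ, 0 ≤ t → ‖x‖ ≤ M * Real.exp (-w * t) * ‖x‖ + M / w * ‖f‖ := by
    intro t ht
    have hb := image_norm_le_of_norm_deriv_right_le_deriv_boundary (a := 0) (b := t)
      hcont.continuousOn (fun s hs => hd s hs.1) h0 hB (hbound t) ⟨ht, le_rfl⟩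
    have h1 : ‖Complex.exp (-(Complex.I * b) * t) • T.op t.toNNReal x‖
        ≤ M * Real.exp (-w * t) * ‖x‖ := by
      rw [norm_smul, hn, one_mul]
      exact hle ht x
    have h2 : M / w * ‖f‖ * (1 - Real.exp (-w * t)) ≤ M / w * ‖f‖ :=
      mul_le_of_le_one_right (by positivity) (by linarith [Real.exp_pos (-w * t)])
    have h3 : ‖x‖ ≤ ‖Complex.exp (-(Complex.I * b) * t) • T.op t.toNNReal x‖
        + ‖Complex.exp (-(Complex.I * b) * t) • T.op t.toNNReal x - x‖ := by
      have := norm_sub_le (Complex.exp (-(Complex.I * b) * t) • T.op t.toNNReal x)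
        (Complex.exp (-(Complex.I * b) * t) • T.op t.toNNReal x - x)
      rwa [sub_sub_cancel] at this
    linarith
  have hlim : Tendsto (fun t : ℝ => M * Real.exp (-w * t) * ‖x‖ + M / w * ‖f‖) atTop
      (𝓝 (M * 0 * ‖x‖ + M / w * ‖f‖)) := by
    have h1 : Tendsto (fun t : ℝ => Real.exp (-w * t)) atTop (𝓝 0) :=
      Real.tendsto_exp_atBot.comp (tendsto_id.const_mul_atTop_of_neg (by linarith))
    exact ((h1.const_mul M).mul_const _).add_const _
  have := ge_of_tendsto hlim ((eventually_ge_atTop 0).mono key)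
  simpa using this

end Orbits

section Unique

variable {H : Type*} [NormedAddCommGroup H] [InnerProductSpace ℂ H] [CompleteSpace H]
  {S T : C0Semigroup H} {A : H →ₗ.[ℂ] H}

/-- A maximal dissipative operator generates at most one semigroup: the difference of two orbits
solves the evolution equation with zero initial value, and its norm decreases. -/
lemma HasGenerator.unique (hA : IsMaxDissipative A) (hS : S.HasGenerator A)
    (hT : T.HasGenerator A) : S = T := by
  have h : S.op = T.op := by
    funext t
    refine ContinuousLinearMap.coeFn_injective
      ((S.op t).continuous.ext_on hA.dense (T.op t).continuous fun x hx => ?_)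
    obtain ⟨y, hxy⟩ := LinearPMap.mem_domain_iff.1 hx
    have h1 := norm_le_of_dissipative
      (u := fun s : ℝ => S.op s.toNNReal x - T.op s.toNNReal x)
      ((S.continuous_orbit_real x).sub (T.continuous_orbit_real x))
      (fun s hs => (hS.hasDerivWithinAt hxy hs).fun_sub (hT.hasDerivWithinAt hxy hs))
      (fun s _ => hA.dissipative
        (A.graph.sub_mem (hS.apply_mem_graph hxy _) (hT.apply_mem_graph hxy _))) t.2
    rw [Real.toNNReal_zero, S.op_zero, T.op_zero, sub_self, norm_zero, norm_le_zero_iff,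
      sub_eq_zero] at h1
    simpa using h1
  cases S
  cases T
  cases h
  rfl

end Unique

end C0Semigroup

/-! ### Resolvents of maximal dissipative operators -/

/-- If `z - A` is bijective then its inverse is bounded. With `J = (1 - A)⁻¹` one has
`z - A = (1 + (z - 1) J) (1 - A)`, and the bounded bijection `1 + (z - 1) J` has a bounded
inverse. -/
lemma IsMaxDissipative.exists_isResolventAt {H : Type*} [NormedAddCommGroup H]
    [InnerProductSpace ℂ H] [CompleteSpace H] {A : H →ₗ.[ℂ] H} (hA : IsMaxDissipative A) {z : ℂ}
    (hinj : ∀ x y, (x, y) ∈ A.graph → z • x - y = 0 → x = 0)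
    (hsurj : ∀ f, ∃ x y, (x, y) ∈ A.graph ∧ z • x - y = f) :
    ∃ R : H →L[ℂ] H, IsResolventAt A z R := by
  set J := hA.res one_pos with hJ
  have hmem : ∀ g, (J g, J g - g) ∈ A.graph := fun g => by
    have := hA.res_mem one_pos g
    rwa [Complex.ofReal_one, one_smul] at this
  have hJapp : ∀ {x y}, (x, y) ∈ A.graph → J (x - y) = x := fun h => by
    have := hA.res_apply one_pos h
    rwa [Complex.ofReal_one, one_smul] at this
  set K : H →L[ℂ] H := 1 + (z - 1) • J with hK
  have hKapp : ∀ g, K g = z • J g - (J g - g) := fun g => by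
    simp only [hK, add_apply, smul_apply, one_apply_eq_self]
    module
  have hker : K.ker = ⊥ := by
    rw [LinearMap.ker_eq_bot']
    intro g hg
    have h1 := hinj _ _ (hmem g) ((hKapp g).symm.trans hg)
    have h2 := hKapp g
    rw [h1, smul_zero, zero_sub, zero_sub, neg_neg] at h2
    exact h2.symm.trans hg
  have hrange : K.range = ⊤ := by
    rw [LinearMap.range_eq_top]
    intro f
    obtain ⟨x, y, hxy, rfl⟩ := hsurj f
    refine ⟨x - y, ?_⟩
    change K (x - y) = _
    rw [hKapp, hJapp hxy, sub_sub_cancel]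
  let E := ContinuousLinearEquiv.ofBijective K hker hrange
  have hE : ∀ f, K (E.symm f) = f := E.apply_symm_apply
  have hright : ∀ f : H, ∃ y : A.domain, (y : H) = J (E.symm f) ∧ z • (y : H) - A y = f := by
    intro f
    obtain ⟨y, hy1, hy2⟩ := (LinearPMap.mem_graph_iff A).1 (hmem (E.symm f))
    refine ⟨y, hy1, ?_⟩
    rw [hy1, hy2, ← hKapp, hE]
  refine ⟨J.comp (E.symm : H →L[ℂ] H), hright, fun y => ?_⟩
  obtain ⟨y', hy', he⟩ := hright (z • (y : H) - A y)
  have h1 := hinj _ _ (A.graph.sub_mem (A.mem_graph y') (A.mem_graph y)) (by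
    rw [← sub_eq_zero] at he
    rw [← he, smul_sub]
    abel)
  exact hy'.symm.trans (sub_eq_zero.1 h1)

namespace StringBeam

/-! ### Calculus of primitives on `[0, π]` -/

lemma IsPrimitive.ext_eq {F : Cont} {f : ℝ → ℂ} (hF : IsPrimitive F f) {x : ℝ}
    (hx : x ∈ Icc 0 Real.pi) : ext F x = F left + ∫ t in (0 : ℝ)..x, f t := by
  rw [← hF ⟨x, hx⟩, ← ext_coe]

lemma intervalIntegrable_of_mem {f : ℝ → ℂ} (hf : IntervalIntegrable f volume 0 Real.pi) {x : ℝ}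
    (hx : x ∈ Icc 0 Real.pi) : IntervalIntegrable f volume 0 x := by
  refine hf.mono_set ?_
  rw [uIcc_of_le hx.1, uIcc_of_le Real.pi_pos.le]
  exact Icc_subset_Icc_right hx.2

lemma IsPrimitive.absolutelyContinuousOnInterval {F : Cont} {f : ℝ → ℂ} (hF : IsPrimitive F f)
    (hf : IntervalIntegrable f volume 0 Real.pi) :
    AbsolutelyContinuousOnInterval (ext F) 0 Real.pi := by
  have h1 := hf.norm.absolutelyContinuousOnInterval_intervalIntegral (c := 0) left_mem_uIcc
  refine squeeze_zero' (Eventually.of_forall fun _ => Finset.sum_nonneg fun _ _ => dist_nonneg)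
    ?_ h1
  rw [eventually_inf_principal]
  refine Eventually.of_forall fun E hE => Finset.sum_le_sum fun i hi => ?_
  have h2 := hE.1 i hi
  rw [uIcc_of_le Real.pi_pos.le] at h2
  have ha := intervalIntegrable_of_mem hf h2.1
  have hb := intervalIntegrable_of_mem hf h2.2
  rw [dist_comm, dist_comm (∫ v in (0 : ℝ)..(E.2 i).1, ‖f v‖), hF.ext_eq h2.1, hF.ext_eq h2.2,
    dist_add_left, dist_eq_norm, Real.dist_eq, intervalIntegral.integral_interval_sub_left hb ha,
    intervalIntegral.integral_interval_sub_left hb.norm ha.norm]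
  exact intervalIntegral.norm_integral_le_abs_integral_norm

lemma IsPrimitive.ae_hasDerivAt {F : Cont} {f : ℝ → ℂ} (hF : IsPrimitive F f)
    (hf : IntervalIntegrable f volume 0 Real.pi) :
    ∀ᵐ x, x ∈ Ioo 0 Real.pi → HasDerivAt (ext F) (f x) x := by
  filter_upwards [hf.ae_hasDerivAt_integral] with x hx hm
  rw [uIcc_of_le Real.pi_pos.le] at hx
  refine ((hx ⟨hm.1.le, hm.2.le⟩ 0 ⟨le_rfl, Real.pi_pos.le⟩).const_add
    (F left)).congr_of_eventuallyEq ?_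
  filter_upwards [Ioo_mem_nhds hm.1 hm.2] with s hs
  exact hF.ext_eq ⟨hs.1.le, hs.2.le⟩

lemma intervalIntegrable_mul_ext {f : ℝ → ℂ} (hf : IntervalIntegrable f volume 0 Real.pi)
    (G : Cont) : IntervalIntegrable (fun x => f x * ext G x) volume 0 Real.pi :=
  hf.mul_continuousOn (ext_continuous G).continuousOn

lemma intervalIntegrable_ext_mul {f : ℝ → ℂ} (hf : IntervalIntegrable f volume 0 Real.pi)
    (G : Cont) : IntervalIntegrable (fun x => ext G x * f x) volume 0 Real.pi :=
  hf.continuousOn_mul (ext_continuous G).continuousOn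

/-- The product rule for absolutely continuous functions. -/
lemma IsPrimitive.mul {F G : Cont} {f g : ℝ → ℂ} (hF : IsPrimitive F f) (hG : IsPrimitive G g)
    (hf : IntervalIntegrable f volume 0 Real.pi) (hg : IntervalIntegrable g volume 0 Real.pi) :
    IsPrimitive (F * G) (fun x => f x * ext G x + ext F x * g x) := by
  set k : ℝ → ℂ := fun x => f x * ext G x + ext F x * g x with hk
  have hki : IntervalIntegrable k volume 0 Real.pi :=
    (intervalIntegrable_mul_ext hf G).add (intervalIntegrable_ext_mul hg F)
  obtain ⟨K, hK⟩ : ∃ K : Cont, ∀ x : Iv, K x = ∫ t in (0 : ℝ)..x, k t := by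
    have hc := intervalIntegral.continuousOn_primitive_interval' hki left_mem_uIcc
    rw [uIcc_of_le Real.pi_pos.le] at hc
    exact ⟨⟨_, hc.domRestrict⟩, fun x => rfl⟩
  have hK0 : K left = 0 := (hK left).trans intervalIntegral.integral_same
  have hKp : IsPrimitive K k := fun x => by rw [hK0, zero_add, hK]
  have hac := ((hF.absolutelyContinuousOnInterval hf).smul
    (hG.absolutelyContinuousOnInterval hg)).sub (hKp.absolutelyContinuousOnInterval hki)
  obtain ⟨C, hC⟩ := hac.const_of_ae_hasDerivAt_zero (by
    have h0 : ∀ᵐ x : ℝ, x ≠ 0 := by simp [ae_iff]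
    have hpi : ∀ᵐ x : ℝ, x ≠ Real.pi := by simp [ae_iff]
    filter_upwards [hF.ae_hasDerivAt hf, hG.ae_hasDerivAt hg, hKp.ae_hasDerivAt hki, h0, hpi]
      with x h1 h2 h3 h4 h5 hx
    rw [uIcc_of_le Real.pi_pos.le] at hx
    have hx' : x ∈ Ioo 0 Real.pi := ⟨lt_of_le_of_ne hx.1 h4.symm, lt_of_le_of_ne hx.2 h5⟩
    refine (((h1 hx').smul (h2 hx')).sub (h3 hx')).congr_deriv ?_
    simp only [hk, smul_eq_mul]
    ring)
  rw [uIcc_of_le Real.pi_pos.le] at hC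
  intro x
  have h1 := hC x x.2
  have h2 := hC left left.2
  simp only [Pi.sub_apply, smul_eq_mul, Pi.mul_apply, ext_coe] at h1 h2
  rw [hK0, sub_zero] at h2
  rw [ContinuousMap.mul_apply, ContinuousMap.mul_apply, h2, ← h1, hK]
  ring

/-- Integration by parts for absolutely continuous functions. -/
lemma IsPrimitive.integral_mul {F G : Cont} {f g : ℝ → ℂ} (hF : IsPrimitive F f)
    (hG : IsPrimitive G g) (hf : IntervalIntegrable f volume 0 Real.pi)
    (hg : IntervalIntegrable g volume 0 Real.pi) :
    (∫ x in (0 : ℝ)..Real.pi, f x * ext G x) + ∫ x in (0 : ℝ)..Real.pi, ext F x * g x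
      = F right * G right - F left * G left := by
  have h := (hF.mul hG hf hg) right
  rw [← intervalIntegral.integral_add (intervalIntegrable_mul_ext hf G)
    (intervalIntegrable_ext_mul hg F), eq_sub_iff_add_eq']
  exact h.symm

lemma exists_isPrimitive {g : ℝ → ℂ} (hg : IntervalIntegrable g volume 0 Real.pi) (a : ℂ) :
    ∃ F : Cont, F left = a ∧ IsPrimitive F g := by
  have hc := intervalIntegral.continuousOn_primitive_interval' hg left_mem_uIcc
  rw [uIcc_of_le Real.pi_pos.le] at hc
  have h0 : a + ∫ t in (0 : ℝ)..(left : ℝ), g t = a := by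
    rw [show (left : ℝ) = 0 from rfl, intervalIntegral.integral_same, add_zero]
  refine ⟨⟨fun x : Iv => a + ∫ t in (0 : ℝ)..x, g t, continuous_const.add hc.domRestrict⟩, h0,
    fun x => ?_⟩
  change _ = (a + ∫ t in (0 : ℝ)..(left : ℝ), g t) + _
  rw [h0]
  rfl

/-- The restriction to `[0, π]` of a continuous function on `ℝ`. -/
noncomputable def restr (φ : ℝ → ℂ) (hφ : Continuous φ) : Cont := ⟨fun x => φ x, by fun_prop⟩

lemma ext_restr {φ : ℝ → ℂ} (hφ : Continuous φ) {x : ℝ} (hx : x ∈ Icc 0 Real.pi) :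
    ext (restr φ hφ) x = φ x := ext_coe (restr φ hφ) ⟨x, hx⟩

lemma isPrimitive_restr {φ φ' : ℝ → ℂ} (h : ∀ x, HasDerivAt φ (φ' x) x) (hφ' : Continuous φ') :
    IsPrimitive (restr φ (continuous_iff_continuousAt.2 fun x => (h x).continuousAt)) φ' := by
  intro x
  have := intervalIntegral.integral_eq_sub_of_hasDerivAt (a := 0) (b := x) (fun t _ => h t)
    (hφ'.intervalIntegrable _ _)
  rw [this]
  change φ x = φ 0 + (φ x - φ 0)
  ring

lemma integral_congr_Icc {f g : ℝ → ℂ} (h : ∀ x ∈ Icc (0 : ℝ) Real.pi, f x = g x) :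
    ∫ x in (0 : ℝ)..Real.pi, f x = ∫ x in (0 : ℝ)..Real.pi, g x := by
  refine intervalIntegral.integral_congr fun x hx => h x ?_
  rwa [uIcc_of_le Real.pi_pos.le] at hx

/-- Integration by parts against a smooth function. -/
lemma IsPrimitive.integral_mul_smooth {F : Cont} {f : ℝ → ℂ} (hF : IsPrimitive F f)
    (hf : IntervalIntegrable f volume 0 Real.pi) {φ φ' : ℝ → ℂ}
    (h : ∀ x, HasDerivAt φ (φ' x) x) (hφ' : Continuous φ') :
    ∫ x in (0 : ℝ)..Real.pi, f x * φ x
      = F right * φ Real.pi - F left * φ 0 - ∫ x in (0 : ℝ)..Real.pi, ext F x * φ' x := by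
  have hφ : Continuous φ := continuous_iff_continuousAt.2 fun x => (h x).continuousAt
  have h1 := hF.integral_mul (isPrimitive_restr h hφ') hf (hφ'.intervalIntegrable _ _)
  rw [eq_sub_iff_add_eq]
  refine Eq.trans ?_ h1
  congr 1
  exact integral_congr_Icc fun x hx => by rw [ext_restr hφ hx]

/-! ### The spaces `H¹` and `H²` -/

lemma h1_isPrimitive (f : H1) : IsPrimitive (h1val f) (h1deriv f) := f.2

lemma h2_isPrimitive (u : H2) : IsPrimitive (h2val u) (ext (h2deriv u)) := u.2.1

lemma h2deriv_isPrimitive (u : H2) : IsPrimitive (h2deriv u) (h2deriv2 u) := u.2.2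

lemma L2_intervalIntegrable_pi (g : L2) : IntervalIntegrable g volume 0 Real.pi :=
  L2_intervalIntegrable g right

/-- The function `u ∈ H²` as an element of `H¹`. -/
noncomputable def h2toH1 (u : H2) : H1 := ⟨(h2val u, toL2 (h2deriv u)), u.2.1.congr (toL2_coe _).symm⟩

/-- The derivative `u' ∈ H¹` of `u ∈ H²`. -/
noncomputable def h2derivH1 (u : H2) : H1 := ⟨(h2deriv u, h2deriv2 u), u.2.2⟩

lemma h1_ext {f g : H1} (h : h1val f = h1val g) : f = g := by
  have : h1val (f - g) = 0 := by
    change h1val f - h1val g = 0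
    rw [h, sub_self]
  exact sub_eq_zero.1 (h1_eq_zero this)

/-- A function in `H¹` whose derivative is in `H¹` is in `H²`. -/
lemma exists_h2 (f p : H1) (h : toL2 (h1val p) = h1deriv f) :
    ∃ u : H2, h2val u = h1val f ∧ h2deriv u = h1val p ∧ h2deriv2 u = h1deriv p :=
  ⟨⟨(h1val f, h1val p, h1deriv p), (h1_isPrimitive f).congr (by rw [← h]; exact toL2_coe _), p.2⟩,
    rfl, rfl, rfl⟩

/-! ### Linear differential equations with constant coefficients -/

lemma exists_solution_first_order (c a : ℂ) (g : L2) :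
    ∃ p : H1, h1val p left = a ∧ h1deriv p = c • toL2 (h1val p) + g := by
  have hd : ∀ k : ℂ, ∀ x : ℝ, HasDerivAt (fun x : ℝ => Complex.exp (k * x))
      (k * Complex.exp (k * x)) x := fun k x => by
    have := ((hasDerivAt_id (x : ℂ)).const_mul k).cexp.comp_ofReal
    simpa [mul_comm] using this
  obtain ⟨Q, hQ0, hQ⟩ := exists_isPrimitive (g := fun x : ℝ => Complex.exp (-c * x) * g x)
    ((L2_intervalIntegrable_pi g).continuousOn_mul (by fun_prop)) a
  have hE := isPrimitive_restr (hd c) (by fun_prop)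
  have hEc : Continuous fun x : ℝ => Complex.exp (c * x) := by fun_prop
  have hF := hE.mul hQ (Continuous.intervalIntegrable (by fun_prop) _ _)
    ((L2_intervalIntegrable_pi g).continuousOn_mul (by fun_prop))
  set E := restr (fun x : ℝ => Complex.exp (c * x)) hEc with hEdef
  have hF' : IsPrimitive (E * Q) (c • toL2 (E * Q) + g : L2) := by
    refine hF.congr ?_
    have h1 : ∀ᵐ x ∂vol, x ∈ Ioo 0 Real.pi := ae_restrict_mem measurableSet_Ioo
    filter_upwards [Lp.coeFn_add (c • toL2 (E * Q)) g, Lp.coeFn_smul c (toL2 (E * Q)),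
      toL2_coe (E * Q), h1] with x h1 h2 h3 hx
    have hx' : x ∈ Icc 0 Real.pi := ⟨hx.1.le, hx.2.le⟩
    have h4 : ext (E * Q) x = Complex.exp (c * x) * ext Q x := by
      rw [← ext_restr hEc hx']
      rfl
    have h5 : Complex.exp (c * x) * Complex.exp (-c * x) = 1 := by
      rw [← Complex.exp_add]
      simp
    rw [h1, Pi.add_apply, h2, Pi.smul_apply, h3, smul_eq_mul, h4, ext_restr hEc hx', ← mul_assoc,
      h5]
    ring
  refine ⟨⟨(E * Q, c • toL2 (E * Q) + g), hF'⟩, ?_, rfl⟩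
  change Complex.exp (c * ((0 : ℝ) : ℂ)) * Q left = a
  rw [hQ0]
  simp

lemma eq_zero_of_first_order {c : ℂ} {p : H1} (h0 : h1val p left = 0)
    (h : h1deriv p = c • toL2 (h1val p)) : p = 0 := by
  have hd : ∀ x : ℝ, HasDerivAt (fun x : ℝ => Complex.exp (-c * x))
      (-c * Complex.exp (-c * x)) x := fun x => by
    have := ((hasDerivAt_id (x : ℂ)).const_mul (-c)).cexp.comp_ofReal
    simpa [mul_comm] using this
  have hEc : Continuous fun x : ℝ => Complex.exp (-c * x) := by fun_prop
  have hF := (isPrimitive_restr hd (by fun_prop)).mul (h1_isPrimitive p)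
    (Continuous.intervalIntegrable (by fun_prop) _ _) (L2_intervalIntegrable_pi _)
  have hz := hF.eq_of_ae_zero (by
    have h1 : ∀ᵐ x ∂vol, x ∈ Ioo 0 Real.pi := ae_restrict_mem measurableSet_Ioo
    filter_upwards [Lp.coeFn_smul c (toL2 (h1val p)), toL2_coe (h1val p), h1] with x h2 h3 hx
    rw [h, h2, Pi.smul_apply, h3, ext_restr hEc ⟨hx.1.le, hx.2.le⟩, smul_eq_mul, Pi.zero_apply]
    ring)
  refine h1_eq_zero (ContinuousMap.ext fun x => ?_)
  have h2 := hz x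
  simp only [ContinuousMap.mul_apply, h0, mul_zero] at h2
  rcases mul_eq_zero.1 h2 with h3 | h3
  · exact absurd h3 (Complex.exp_ne_zero _)
  · exact h3

/-- The initial value problem `u'' = k² u + g`, solved by factoring `∂² - k² = (∂ + k)(∂ - k)`. -/
lemma exists_solution_second_order (k a b : ℂ) (g : L2) :
    ∃ u : H2, h2val u left = a ∧ h2deriv u left = b ∧
      h2deriv2 u = k ^ 2 • toL2 (h2val u) + g := by
  obtain ⟨w, hw0, hw⟩ := exists_solution_first_order (-k) (b - k * a) g
  obtain ⟨v, hv0, hv⟩ := exists_solution_first_order k a (toL2 (h1val w))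
  obtain ⟨u, h1, h2, h3⟩ := exists_h2 v (k • v + w) (by
    rw [hv]
    exact (map_add toL2 _ _).trans (congrArg (· + _) (map_smul toL2 k _)))
  refine ⟨u, by rw [h1, hv0], ?_, ?_⟩
  · rw [h2]
    change k * h1val v left + h1val w left = b
    rw [hv0, hw0]
    ring
  · rw [h3, h1]
    change k • h1deriv v + h1deriv w = _
    rw [hv, hw]
    module

lemma eq_zero_of_second_order {k : ℂ} {u : H2} (h0 : h2val u left = 0) (h1 : h2deriv u left = 0)
    (h : h2deriv2 u = k ^ 2 • toL2 (h2val u)) : u = 0 := by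
  have hw : h2derivH1 u - k • h2toH1 u = 0 := by
    refine eq_zero_of_first_order (c := -k) ?_ ?_
    · change h2deriv u left - k * h2val u left = 0
      rw [h0, h1]
      ring
    · change h2deriv2 u - k • toL2 (h2deriv u) = -k • toL2 (h2deriv u - k • h2val u)
      rw [h, map_sub, map_smul]
      module
  have h2 : h2toH1 u = 0 := by
    refine eq_zero_of_first_order (c := k) h0 ?_
    have h3 : h2deriv u = k • h2val u := sub_eq_zero.1 (congrArg h1val hw)
    change toL2 (h2deriv u) = _
    rw [h3, map_smul]
    rfl
  exact h2_eq_zero (congrArg h1val h2)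

/-- Green's identity for the second derivative against a smooth function. -/
lemma green (u : H2) {φ φ' φ'' : ℝ → ℂ} (h : ∀ x, HasDerivAt φ (φ' x) x)
    (h' : ∀ x, HasDerivAt φ' (φ'' x) x) (hφ'' : Continuous φ'') :
    ∫ x in (0 : ℝ)..Real.pi, h2deriv2 u x * φ x
      = h2deriv u right * φ Real.pi - h2deriv u left * φ 0
        - (h2val u right * φ' Real.pi - h2val u left * φ' 0)
        + ∫ x in (0 : ℝ)..Real.pi, ext (h2val u) x * φ'' x := by
  have hφ' : Continuous φ' := continuous_iff_continuousAt.2 fun x => (h' x).continuousAt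
  rw [(h2deriv_isPrimitive u).integral_mul_smooth (L2_intervalIntegrable_pi _) h hφ',
    (h2_isPrimitive u).integral_mul_smooth ((ext_continuous _).intervalIntegrable _ _) h' hφ'']
  ring

/-! ### Inner products in `L²(0, π)` -/

lemma integral_vol (f : ℝ → ℂ) : ∫ x, f x ∂vol = ∫ x in (0 : ℝ)..Real.pi, f x := by
  rw [intervalIntegral.integral_of_le Real.pi_pos.le, ← restrict_Ioo_eq_restrict_Ioc]

lemma inner_L2_eq (f g : L2) :
    inner ℂ f g = ∫ x in (0 : ℝ)..Real.pi, starRingEnd ℂ (f x) * g x := by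
  rw [L2.inner_def, ← integral_vol]
  refine integral_congr_ae (Eventually.of_forall fun x => ?_)
  simp only [RCLike.inner_apply]
  ring

lemma integral_congr_pi {g k : ℝ → ℂ} (h : g =ᵐ[vol] k) :
    ∫ t in (0 : ℝ)..Real.pi, g t = ∫ t in (0 : ℝ)..Real.pi, k t := integral_congr h right

lemma inner_toL2_left (F : Cont) (g : L2) :
    inner ℂ (toL2 F) g = ∫ x in (0 : ℝ)..Real.pi, starRingEnd ℂ (ext F x) * g x := by
  rw [inner_L2_eq]
  refine integral_congr_pi ?_
  filter_upwards [toL2_coe F] with x hx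
  rw [hx]

lemma inner_toL2_right (f : L2) (G : Cont) :
    inner ℂ f (toL2 G) = ∫ x in (0 : ℝ)..Real.pi, starRingEnd ℂ (f x) * ext G x := by
  rw [inner_L2_eq]
  refine integral_congr_pi ?_
  filter_upwards [toL2_coe G] with x hx
  rw [hx]

lemma inner_one (g : L2) : inner ℂ (toL2 1) g = ∫ x in (0 : ℝ)..right, g x := by
  rw [inner_toL2_left]
  refine intervalIntegral.integral_congr fun x _ => ?_
  change starRingEnd ℂ 1 * g x = g x
  rw [map_one, one_mul]

lemma IsPrimitive.star {F : Cont} {f : ℝ → ℂ} (hF : IsPrimitive F f) :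
    IsPrimitive (star F) (fun x => starRingEnd ℂ (f x)) := by
  intro x
  change starRingEnd ℂ (F x) = starRingEnd ℂ (F left) + _
  rw [hF x, map_add, intervalIntegral.intervalIntegral_eq_integral_uIoc,
    intervalIntegral.intervalIntegral_eq_integral_uIoc, Complex.real_smul, Complex.real_smul,
    map_mul, Complex.conj_ofReal, integral_conj]

lemma intervalIntegrable_star {f : ℝ → ℂ} (hf : IntervalIntegrable f volume 0 Real.pi) :
    IntervalIntegrable (fun x => starRingEnd ℂ (f x)) volume 0 Real.pi := by
  rw [intervalIntegrable_iff] at hf ⊢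
  exact (Complex.conjCLE : ℂ →L[ℝ] ℂ).integrable_comp hf

/-- Integration by parts in `H¹(0, π)`. -/
lemma inner_deriv_add (f p : H1) :
    inner ℂ (h1deriv f) (toL2 (h1val p)) + inner ℂ (toL2 (h1val f)) (h1deriv p)
      = starRingEnd ℂ (h1val f right) * h1val p right
        - starRingEnd ℂ (h1val f left) * h1val p left := by
  rw [inner_toL2_left, inner_toL2_right]
  exact (h1_isPrimitive f).star.integral_mul (h1_isPrimitive p)
    (intervalIntegrable_star (L2_intervalIntegrable_pi _)) (L2_intervalIntegrable_pi _)

/-! ### The energy space is a Hilbert space -/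

lemma boundary_conditions (y : EnergySpace) : h1val y.u1 right = 0 ∧
    h1val y.u1 left = h2val y.u2 left ∧ h2deriv y.u2 left = 0 ∧ h2deriv y.u2 right = 0 := by
  obtain ⟨⟨u, f, g, rfl, h⟩, v⟩ := y
  exact h

/-- The element `(f, g, c, d)` of the energy space. -/
noncomputable def mkEnergy (f : H1) (g : H2) (h : h1val f right = 0 ∧ h1val f left = h2val g left ∧
    h2deriv g left = 0 ∧ h2deriv g right = 0) (c d : L2) : EnergySpace :=
  (⟨(f.1, g.1), f, g, rfl, h⟩, c, d)

lemma inner_energy (y z : EnergySpace) : inner ℂ y z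
    = inner ℂ (h1deriv y.u1) (h1deriv z.u1) + inner ℂ (h2deriv2 y.u2) (h2deriv2 z.u2)
      + inner ℂ y.v1 z.v1 + inner ℂ y.v2 z.v2 := rfl

lemma norm_sq_energy (y : EnergySpace) : ‖y‖ ^ 2
    = ‖h1deriv y.u1‖ ^ 2 + ‖h2deriv2 y.u2‖ ^ 2 + ‖y.v1‖ ^ 2 + ‖y.v2‖ ^ 2 := by
  have h := inner_energy y y
  simp only [inner_self_eq_norm_sq_to_K] at h
  exact_mod_cast h

lemma norm_components_le (y : EnergySpace) :
    ‖h1deriv y.u1‖ ≤ ‖y‖ ∧ ‖h2deriv2 y.u2‖ ≤ ‖y‖ ∧ ‖y.v1‖ ≤ ‖y‖ ∧ ‖y.v2‖ ≤ ‖y‖ := by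
  have h := norm_sq_energy y
  have h1 := sq_nonneg ‖h1deriv y.u1‖
  have h2 := sq_nonneg ‖h2deriv2 y.u2‖
  have h3 := sq_nonneg ‖y.v1‖
  have h4 := sq_nonneg ‖y.v2‖
  refine ⟨?_, ?_, ?_, ?_⟩ <;> exact abs_le_of_sq_le_sq' (by linarith) (norm_nonneg y) |>.2

lemma exists_energy (a b c d : L2) (hb : inner ℂ (toL2 1) b = 0) :
    ∃ y : EnergySpace, h1deriv y.u1 = a ∧ h2deriv2 y.u2 = b ∧ y.v1 = c ∧ y.v2 = d := by
  obtain ⟨F, hF0, hF⟩ := exists_isPrimitive (L2_intervalIntegrable_pi a)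
    (-∫ t in (0 : ℝ)..Real.pi, a t)
  obtain ⟨G', hG'0, hG'⟩ := exists_isPrimitive (L2_intervalIntegrable_pi b) 0
  obtain ⟨G, hG0, hG⟩ := exists_isPrimitive ((ext_continuous G').intervalIntegrable _ _) (F left)
  have hFr : F right = 0 := by
    rw [hF right, hF0]
    exact neg_add_cancel _
  have hG'r : G' right = 0 := by
    rw [hG' right, hG'0, zero_add]
    exact (inner_one b).symm.trans hb
  exact ⟨mkEnergy ⟨(F, a), hF⟩ ⟨(G, G', b), hG, hG'⟩ ⟨hFr, hG0.symm, hG'0, hG'r⟩ c d,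
    rfl, rfl, rfl, rfl⟩

lemma inner_one_h2deriv2 (y : EnergySpace) : inner ℂ (toL2 1) (h2deriv2 y.u2) = 0 := by
  have h := h2deriv_isPrimitive y.u2 right
  rw [(boundary_conditions y).2.2.1, (boundary_conditions y).2.2.2, zero_add] at h
  exact (inner_one _).trans h.symm

instance : CompleteSpace EnergySpace := by
  refine Metric.complete_of_cauchySeq_tendsto fun y hy => ?_
  have hc : ∀ φ : EnergySpace → L2, (∀ a b, φ (a - b) = φ a - φ b) → (∀ a, ‖φ a‖ ≤ ‖a‖) →
      ∃ l, Tendsto (fun n => φ (y n)) atTop (𝓝 l) := by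
    intro φ h1 h2
    refine cauchySeq_tendsto_of_complete (Metric.cauchySeq_iff.2 fun ε hε => ?_)
    obtain ⟨N, hN⟩ := Metric.cauchySeq_iff.1 hy ε hε
    refine ⟨N, fun m hm n hn => ?_⟩
    rw [dist_eq_norm, ← h1]
    exact (h2 _).trans_lt (by rw [← dist_eq_norm]; exact hN m hm n hn)
  obtain ⟨a, ha⟩ := hc (fun y => h1deriv y.u1) (fun _ _ => rfl) fun y => (norm_components_le y).1
  obtain ⟨b, hb⟩ := hc (fun y => h2deriv2 y.u2) (fun _ _ => rfl)
    fun y => (norm_components_le y).2.1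
  obtain ⟨c, hc'⟩ := hc (fun y => y.v1) (fun _ _ => rfl) fun y => (norm_components_le y).2.2.1
  obtain ⟨d, hd⟩ := hc (fun y => y.v2) (fun _ _ => rfl) fun y => (norm_components_le y).2.2.2
  have hb0 : inner ℂ (toL2 1) b = 0 := by
    refine tendsto_nhds_unique (tendsto_const_nhds.inner hb) ?_
    simp only [inner_one_h2deriv2]
    exact tendsto_const_nhds
  obtain ⟨l, h1, h2, h3, h4⟩ := exists_energy a b c d hb0
  refine ⟨l, ?_⟩
  rw [tendsto_iff_norm_sub_tendsto_zero]
  have hz : ∀ {φ : ℕ → L2} {l : L2}, Tendsto φ atTop (𝓝 l) →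
      Tendsto (fun n => ‖φ n - l‖ ^ 2) atTop (𝓝 0) := by
    intro φ l h
    simpa using (tendsto_iff_norm_sub_tendsto_zero.1 h).pow 2
  have hsq : Tendsto (fun n => ‖y n - l‖ ^ 2) atTop (𝓝 0) := by
    have h := (((hz ha).add (hz hb)).add (hz hc')).add (hz hd)
    simp only [add_zero] at h
    refine h.congr fun n => ?_
    rw [norm_sq_energy, ← h1, ← h2, ← h3, ← h4]
    rfl
  have := hsq.sqrt
  simpa using this

/-! ### The operator is dissipative -/

/-- The graph of the operator, with `u¹` regarded as an element `U` of `H²`. -/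
lemma mem_graph_iff {y z : EnergySpace} : (y, z) ∈ op.graph ↔
    toL2 (h1val z.u1) = y.v1 ∧ toL2 (h2val z.u2) = y.v2 ∧
    ∃ U q : H2, h2toH1 U = y.u1 ∧ h2deriv2 U = z.v1 ∧
      toL2 (h2val q) = h2deriv2 y.u2 ∧ h2deriv2 q = -z.v2 ∧
      h2deriv q left = h2deriv U left ∧ h2deriv q right = h2val z.u2 right := by
  rw [op_graph]
  constructor
  · rintro ⟨h1, h2, p, q, h3, h4, h5, h6, h7, h8⟩
    obtain ⟨U, k1, k2, k3⟩ := exists_h2 _ p h3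
    exact ⟨h1, h2, U, q, h1_ext k1, k3.trans h4.symm, h5, (neg_eq_iff_eq_neg.2 h6).symm,
      h7.trans (congrArg (fun F : Cont => F left) k2).symm, h8⟩
  · rintro ⟨h1, h2, U, q, h3, h4, h5, h6, h7, h8⟩
    exact ⟨h1, h2, h2derivH1 U, q, by rw [← h3]; rfl, h4.symm, h5,
      (neg_eq_iff_eq_neg.2 h6).symm, h7, h8⟩

/-- The dissipation law: the energy is lost through the feedback at `π` only. -/
lemma re_inner_of_mem_graph {y z : EnergySpace} (h : (y, z) ∈ op.graph) :
    (inner ℂ y z).re = -‖h2val z.u2 right‖ ^ 2 := by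
  obtain ⟨h1, h2, U, q, h3, h4, h5, h6, h7, h8⟩ := mem_graph_iff.1 h
  obtain ⟨b1, b2, b3, b4⟩ := boundary_conditions z
  have hU : toL2 (h2deriv U) = h1deriv y.u1 := by rw [← h3]; rfl
  rw [inner_energy, ← h1, ← h2, ← h4, ← hU, ← h5, ← neg_eq_iff_eq_neg.2 h6, inner_neg_right]
  have e1 := inner_deriv_add z.u1 (h2derivH1 U)
  have e2 := inner_deriv_add (h2derivH1 z.u2) (h2toH1 q)
  have e3 := inner_deriv_add (h2toH1 z.u2) (h2derivH1 q)
  change inner ℂ (h1deriv z.u1) (toL2 (h2deriv U)) + inner ℂ (toL2 (h1val z.u1)) (h2deriv2 U)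
    = starRingEnd ℂ (h1val z.u1 right) * h2deriv U right
      - starRingEnd ℂ (h1val z.u1 left) * h2deriv U left at e1
  change inner ℂ (h2deriv2 z.u2) (toL2 (h2val q)) + inner ℂ (toL2 (h2deriv z.u2))
      (toL2 (h2deriv q)) = starRingEnd ℂ (h2deriv z.u2 right) * h2val q right
      - starRingEnd ℂ (h2deriv z.u2 left) * h2val q left at e2
  change inner ℂ (toL2 (h2deriv z.u2)) (toL2 (h2deriv q)) + inner ℂ (toL2 (h2val z.u2))
      (h2deriv2 q) = starRingEnd ℂ (h2val z.u2 right) * h2deriv q right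
      - starRingEnd ℂ (h2val z.u2 left) * h2deriv q left at e3
  rw [b1, b2, map_zero] at e1
  rw [b3, b4, map_zero] at e2
  rw [h7, h8] at e3
  have s1 : (inner ℂ (toL2 (h2deriv U)) (h1deriv z.u1)).re
      = (inner ℂ (h1deriv z.u1) (toL2 (h2deriv U))).re := inner_re_symm (𝕜 := ℂ) _ _
  have s2 : (inner ℂ (toL2 (h2val q)) (h2deriv2 z.u2)).re
      = (inner ℂ (h2deriv2 z.u2) (toL2 (h2val q))).re := inner_re_symm (𝕜 := ℂ) _ _
  have r1 := congrArg Complex.re e1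
  have r2 := congrArg Complex.re e2
  have r3 := congrArg Complex.re e3
  have s3 : (starRingEnd ℂ (h2val z.u2 right) * h2val z.u2 right).re = ‖h2val z.u2 right‖ ^ 2 := by
    rw [Complex.conj_mul']
    norm_cast
  simp only [Complex.add_re, Complex.sub_re, Complex.neg_re, zero_mul, Complex.zero_re] at r1 r2 r3 ⊢
  rw [s3] at r3
  linarith

/-! ### The resolvent equation as a boundary value problem -/

/-- The inclusion of `H²` in the continuous functions. -/
noncomputable def valL : H2 →ₗ[ℂ] Cont where
  toFun := h2val
  map_add' _ _ := rfl
  map_smul' _ _ := rfl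

/-- `u ↦ u'` on `H²`. -/
noncomputable def derivL : H2 →ₗ[ℂ] Cont where
  toFun := h2deriv
  map_add' _ _ := rfl
  map_smul' _ _ := rfl

/-- `u ↦ u''` on `H²`. -/
noncomputable def deriv2L : H2 →ₗ[ℂ] L2 where
  toFun := h2deriv2
  map_add' _ _ := rfl
  map_smul' _ _ := rfl

/-- Evaluation of a continuous function at a point. -/
noncomputable def evalL (x : Iv) : Cont →ₗ[ℂ] ℂ where
  toFun F := F x
  map_add' _ _ := rfl
  map_smul' _ _ := rfl

/-- The differential operator `u ↦ u'' - k² u` on `H²`. -/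
noncomputable def diffL (k : ℂ) : H2 →ₗ[ℂ] L2 := deriv2L - k ^ 2 • toL2 ∘ₗ valL

lemma diffL_apply (k : ℂ) (u : H2) : diffL k u = h2deriv2 u - k ^ 2 • toL2 (h2val u) := rfl

/-- The initial data `(u(0), u'(0))`. -/
noncomputable def initL : H2 →ₗ[ℂ] ℂ × ℂ :=
  (evalL left ∘ₗ valL).prod (evalL left ∘ₗ derivL)

lemma initL_apply (u : H2) : initL u = (h2val u left, h2deriv u left) := rfl

/-- Triples `(u, w, v)`: the string `u`, the beam `v`, and `w = v'' - r² v` for a root `r⁴ = -k²`. -/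
abbrev Triple : Type := H2 × H2 × H2

/-- The initial data of a triple; the six boundary values live in the same space. -/
abbrev Data : Type := (ℂ × ℂ) × (ℂ × ℂ) × (ℂ × ℂ)

/-- The Cauchy problem for the string `u'' - k² u` and the beam, where the fourth order operator
`v'''' - r⁴ v` is split into `v'' - r² v = w`, `w'' + r² w = v'''' - r⁴ v`. -/
noncomputable def cauchyL (k r : ℂ) : Triple →ₗ[ℂ] (L2 × L2 × L2) × Data :=
  let pu : Triple →ₗ[ℂ] H2 := LinearMap.fst ℂ _ _
  let pw : Triple →ₗ[ℂ] H2 := LinearMap.fst ℂ _ _ ∘ₗ LinearMap.snd ℂ _ _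
  let pv : Triple →ₗ[ℂ] H2 := LinearMap.snd ℂ _ _ ∘ₗ LinearMap.snd ℂ _ _
  ((diffL k ∘ₗ pu).prod ((diffL (Complex.I * r) ∘ₗ pw).prod
    (diffL r ∘ₗ pv - toL2 ∘ₗ valL ∘ₗ pw))).prod
    ((initL ∘ₗ pu).prod ((initL ∘ₗ pw).prod (initL ∘ₗ pv)))

lemma cauchyL_apply (k r : ℂ) (u w v : H2) : cauchyL k r (u, w, v) =
    ((diffL k u, diffL (Complex.I * r) w, diffL r v - toL2 (h2val w)),
      (initL u, initL w, initL v)) := rfl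

lemma diffL_eq_zero {k : ℂ} {u : H2} (h : diffL k u = 0) (h0 : initL u = 0) : u = 0 := by
  rw [initL_apply, Prod.mk_eq_zero] at h0
  exact eq_zero_of_second_order h0.1 h0.2 (sub_eq_zero.1 h)

lemma exists_diffL_eq (k : ℂ) (g : L2) (c : ℂ × ℂ) : ∃ u, diffL k u = g ∧ initL u = c := by
  obtain ⟨u, h1, h2, h3⟩ := exists_solution_second_order k c.1 c.2 g
  exact ⟨u, by rw [diffL_apply, h3, add_sub_cancel_left], Prod.ext h1 h2⟩

lemma cauchyL_bijective (k r : ℂ) : Function.Bijective (cauchyL k r) := by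
  constructor
  · rw [injective_iff_map_eq_zero]
    rintro ⟨u, w, v⟩ h
    rw [cauchyL_apply] at h
    simp only [Prod.mk_eq_zero] at h
    obtain ⟨⟨h1, h2, h3⟩, h4, h5, h6⟩ := h
    have hu := diffL_eq_zero h1 h4
    have hw := diffL_eq_zero h2 h5
    subst hu hw
    have hv : v = 0 := diffL_eq_zero (sub_eq_zero.1 h3 |>.trans (map_zero toL2)) h6
    rw [hv]
    rfl
  · rintro ⟨⟨g1, g2, g3⟩, c1, c2, c3⟩
    obtain ⟨u, hu, hu'⟩ := exists_diffL_eq k g1 c1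
    obtain ⟨w, hw, hw'⟩ := exists_diffL_eq (Complex.I * r) g2 c2
    obtain ⟨v, hv, hv'⟩ := exists_diffL_eq r (g3 + toL2 (h2val w)) c3
    refine ⟨(u, w, v), ?_⟩
    rw [cauchyL_apply, hu, hu', hw, hw', hv, hv', add_sub_cancel_right]

/-- The boundary operator
`(u(π), u(0) - v(0)), (v'(0), v'(π)), (q'(0) - u'(0), q'(π) - k v(π))`, where `q = r² v + w` is the
second derivative of `v`. -/
noncomputable def boundaryL (k r : ℂ) : Triple →ₗ[ℂ] Data :=
  let pu : Triple →ₗ[ℂ] H2 := LinearMap.fst ℂ _ _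
  let pw : Triple →ₗ[ℂ] H2 := LinearMap.fst ℂ _ _ ∘ₗ LinearMap.snd ℂ _ _
  let pv : Triple →ₗ[ℂ] H2 := LinearMap.snd ℂ _ _ ∘ₗ LinearMap.snd ℂ _ _
  let q : Triple →ₗ[ℂ] H2 := r ^ 2 • pv + pw
  ((evalL right ∘ₗ valL ∘ₗ pu).prod
      (evalL left ∘ₗ valL ∘ₗ pu - evalL left ∘ₗ valL ∘ₗ pv)).prod
    (((evalL left ∘ₗ derivL ∘ₗ pv).prod (evalL right ∘ₗ derivL ∘ₗ pv)).prod
      ((evalL left ∘ₗ derivL ∘ₗ q - evalL left ∘ₗ derivL ∘ₗ pu).prod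
        (evalL right ∘ₗ derivL ∘ₗ q - k • evalL right ∘ₗ valL ∘ₗ pv)))

lemma boundaryL_apply (k r : ℂ) (u w v : H2) : boundaryL k r (u, w, v) =
    ((h2val u right, h2val u left - h2val v left), (h2deriv v left, h2deriv v right),
      (h2deriv (r ^ 2 • v + w) left - h2deriv u left,
        h2deriv (r ^ 2 • v + w) right - k * h2val v right)) := rfl

/-- A solution of the boundary value problem solves the resolvent equation `(k - 𝒜) y = f`. -/
lemma exists_mem_graph {k r : ℂ} (hr : r ^ 4 = -k ^ 2) (f : EnergySpace) {u w v : H2}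
    (hu : diffL k u = -(k • toL2 (h1val f.u1)) - f.v1)
    (hw : diffL (Complex.I * r) w = k • toL2 (h2val f.u2) + f.v2)
    (hv : diffL r v = toL2 (h2val w))
    (hb : boundaryL k r (u, w, v) = ((0, 0), (0, 0), (0, -h2val f.u2 right))) :
    ∃ y, (y, k • y - f) ∈ op.graph ∧ y.u1 = h2toH1 u ∧ y.u2 = v := by
  rw [boundaryL_apply] at hb
  simp only [Prod.mk.injEq] at hb
  obtain ⟨⟨b1, b2⟩, ⟨b3, b4⟩, b5, b6⟩ := hb
  rw [diffL_apply, sub_eq_iff_eq_add] at hu hw hv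
  refine ⟨mkEnergy (h2toH1 u) v ⟨b1, sub_eq_zero.1 b2, b3, b4⟩
    (toL2 (k • h2val u - h1val f.u1)) (toL2 (k • h2val v - h2val f.u2)), ?_, rfl, rfl⟩
  rw [mem_graph_iff]
  refine ⟨rfl, rfl, u, r ^ 2 • v + w, rfl, ?_, ?_, ?_, sub_eq_zero.1 b5, ?_⟩
  · change h2deriv2 u = k • toL2 (k • h2val u - h1val f.u1) - f.v1
    rw [hu, map_sub, map_smul]
    module
  · change toL2 (r ^ 2 • h2val v + h2val w) = h2deriv2 v
    rw [hv, map_add, map_smul, add_comm]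
  · change r ^ 2 • h2deriv2 v + h2deriv2 w = -(k • toL2 (k • h2val v - h2val f.u2) - f.v2)
    have e1 : (Complex.I * r) ^ 2 = -r ^ 2 := by rw [mul_pow, Complex.I_sq]; ring
    have e2 : r ^ 2 * r ^ 2 = -k ^ 2 := by rw [← hr]; ring
    rw [hv, hw, e1, map_sub, map_smul, smul_add, smul_smul, e2]
    module
  · change h2deriv (r ^ 2 • v + w) right = k * h2val v right - h2val f.u2 right
    linear_combination b6

/-- If `k - 𝒜` is injective then it is onto: after elimination of the inhomogeneities this is a
statement on the boundary operator, a linear map between spaces of dimension six. -/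
lemma surjective_of_injective {k : ℂ}
    (hinj : ∀ y z, (y, z) ∈ op.graph → k • y - z = 0 → y = 0) (f : EnergySpace) :
    ∃ y z, (y, z) ∈ op.graph ∧ k • y - z = f := by
  obtain ⟨r, hr⟩ := IsAlgClosed.exists_pow_nat_eq (-k ^ 2) (n := 4) (by norm_num)
  let S := LinearEquiv.ofBijective (cauchyL k r) (cauchyL_bijective k r)
  have hS : ∀ d, cauchyL k r (S.symm d) = d := S.apply_symm_apply
  -- the boundary values of the homogeneous solution with given initial data
  let B : Data →ₗ[ℂ] Data :=
    boundaryL k r ∘ₗ S.symm.toLinearMap ∘ₗ LinearMap.inr ℂ (L2 × L2 × L2) Data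
  have hBapp : ∀ c, B c = boundaryL k r (S.symm (0, c)) := fun _ => rfl
  have hB : Function.Injective B := by
    rw [injective_iff_map_eq_zero]
    intro c hc
    rw [hBapp] at hc
    have h0 := hS (0, c)
    obtain ⟨⟨u, w, v⟩, hx⟩ : ∃ x, x = S.symm (0, c) := ⟨_, rfl⟩
    rw [← hx] at hc h0
    rw [cauchyL_apply] at h0
    simp only [Prod.mk.injEq, Prod.mk_eq_zero] at h0
    obtain ⟨⟨h1, h2, h3⟩, h4⟩ := h0
    obtain ⟨y, hy, hy1, hy2⟩ := exists_mem_graph hr 0 (u := u) (w := w) (v := v)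
      (h1.trans (by
        change 0 = -(k • toL2 0) - (0 : L2)
        rw [map_zero, smul_zero, neg_zero, sub_zero]))
      (h2.trans (by
        change 0 = k • toL2 0 + (0 : L2)
        rw [map_zero, smul_zero, add_zero])) (sub_eq_zero.1 h3)
      (hc.trans (by
        change _ = ((0, 0), (0, 0), (0, -(0 : ℂ)))
        rw [neg_zero]
        rfl))
    have hy0 := hinj _ _ hy (by rw [sub_zero, sub_self])
    subst hy0
    have hu : u = 0 := h2_eq_zero (congrArg h1val hy1).symm
    have hv : v = 0 := hy2.symm
    subst hu hv
    have hw : w = 0 := by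
      refine h2_eq_zero (toL2_injective ?_)
      rw [map_zero] at h3 ⊢
      exact neg_eq_zero.1 ((zero_sub _).symm.trans h3)
    subst hw
    rw [← h4]
    rfl
  have hB' : Function.Surjective B := LinearMap.injective_iff_surjective.1 hB
  set g : L2 × L2 × L2 :=
    (-(k • toL2 (h1val f.u1)) - f.v1, k • toL2 (h2val f.u2) + f.v2, 0) with hg
  obtain ⟨c, hc⟩ := hB' (((0, 0), (0, 0), (0, -h2val f.u2 right)) - boundaryL k r (S.symm (g, 0)))
  have h1 : boundaryL k r (S.symm (g, c)) = ((0, 0), (0, 0), (0, -h2val f.u2 right)) := by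
    have e : ((g, c) : (L2 × L2 × L2) × Data) = (0, c) + (g, 0) := by simp
    rw [e, map_add, map_add, ← hBapp, hc, sub_add_cancel]
  have h2 := hS (g, c)
  obtain ⟨⟨u, w, v⟩, hx⟩ : ∃ x, x = S.symm (g, c) := ⟨_, rfl⟩
  rw [← hx] at h1 h2
  rw [cauchyL_apply, hg] at h2
  simp only [Prod.mk.injEq] at h2
  obtain ⟨⟨k1, k2, k3⟩, -⟩ := h2
  obtain ⟨y, hy, -, -⟩ := exists_mem_graph hr f k1 k2 (sub_eq_zero.1 k3) h1
  exact ⟨y, _, hy, sub_sub_cancel _ _⟩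

theorem isMaxDissipative_op : IsMaxDissipative op := by
  have hd : ∀ {x y : EnergySpace}, (x, y) ∈ op.graph → (inner ℂ x y).re ≤ 0 := fun h => by
    rw [re_inner_of_mem_graph h]
    exact neg_nonpos.2 (by positivity)
  refine ⟨hd, fun r hr => surjective_of_injective fun y z hyz h => ?_⟩
  have h1 := hd hyz
  rw [← sub_eq_zero.1 h, inner_smul_right, inner_self_eq_norm_sq_to_K, Complex.re_ofReal_mul] at h1
  have h2 : r * ‖y‖ ^ 2 ≤ 0 := by exact_mod_cast h1
  rw [← norm_eq_zero]
  exact pow_eq_zero_iff two_ne_zero |>.1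
    (le_antisymm (nonpos_of_mul_nonpos_right h2 hr) (by positivity))

/-! ### The equation on the imaginary axis -/

lemma integral_toL2_smul_mul (c : ℂ) (F : Cont) (φ : ℝ → ℂ) :
    ∫ x in (0 : ℝ)..Real.pi, (c • toL2 F : L2) x * φ x
      = c * ∫ x in (0 : ℝ)..Real.pi, ext F x * φ x := by
  rw [← intervalIntegral.integral_const_mul]
  refine integral_congr_pi ?_
  filter_upwards [Lp.coeFn_smul c (toL2 F), toL2_coe F] with x h1 h2
  rw [h1, Pi.smul_apply, h2, smul_eq_mul, mul_assoc]

/-- Green's identity for the equation `v'''' = μ v`, where `q = v''`. -/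
lemma beam_identity {v q : H2} {μ : ℂ} (hq : toL2 (h2val q) = h2deriv2 v)
    (hq'' : h2deriv2 q = μ • toL2 (h2val v)) (h0 : h2deriv v left = 0) (hπ : h2deriv v right = 0)
    {φ φ₁ φ₂ φ₃ : ℝ → ℂ} (h₁ : ∀ x, HasDerivAt φ (φ₁ x) x) (h₂ : ∀ x, HasDerivAt φ₁ (φ₂ x) x)
    (h₃ : ∀ x, HasDerivAt φ₂ (φ₃ x) x) (h₄ : ∀ x, HasDerivAt φ₃ (μ * φ x) x) :
    h2deriv q right * φ Real.pi - h2deriv q left * φ 0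
      - (h2val q right * φ₁ Real.pi - h2val q left * φ₁ 0)
      - (h2val v right * φ₃ Real.pi - h2val v left * φ₃ 0) = 0 := by
  have c0 : Continuous φ := continuous_iff_continuousAt.2 fun x => (h₁ x).continuousAt
  have c2 : Continuous φ₂ := continuous_iff_continuousAt.2 fun x => (h₃ x).continuousAt
  have e1 := green q h₁ h₂ c2
  have e2 := green v h₃ h₄ (by fun_prop)
  have e3 : ∫ x in (0 : ℝ)..Real.pi, ext (h2val q) x * φ₂ x
      = ∫ x in (0 : ℝ)..Real.pi, h2deriv2 v x * φ₂ x := by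
    rw [← hq, ← one_smul ℂ (toL2 (h2val q)), integral_toL2_smul_mul, one_mul]
  have e4 : ∫ x in (0 : ℝ)..Real.pi, ext (h2val v) x * (μ * φ x)
      = μ * ∫ x in (0 : ℝ)..Real.pi, ext (h2val v) x * φ x := by
    rw [← intervalIntegral.integral_const_mul]
    exact integral_congr_Icc fun x _ => by ring
  rw [hq'', integral_toL2_smul_mul, e3, e2, e4, h0, hπ] at e1
  linear_combination -e1

/-- Green's identity of the beam against the four exponential solutions of `φ'''' = a⁴ φ`. -/
lemma beam_relations {v q : H2} {a : ℝ} (hq : toL2 (h2val q) = h2deriv2 v)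
    (hq'' : h2deriv2 q = (a : ℂ) ^ 4 • toL2 (h2val v)) (h0 : h2deriv v left = 0)
    (hπ : h2deriv v right = 0) :
    (h2deriv q right * Real.cos (a * Real.pi) - h2deriv q left
      + h2val q right * a * Real.sin (a * Real.pi)
      - h2val v right * a ^ 3 * Real.sin (a * Real.pi) = 0) ∧
    (h2deriv q right * Real.sin (a * Real.pi)
      - h2val q right * a * Real.cos (a * Real.pi) + h2val q left * a
      + h2val v right * a ^ 3 * Real.cos (a * Real.pi) - h2val v left * a ^ 3 = 0) ∧
    (h2deriv q right * Real.cosh (a * Real.pi) - h2deriv q left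
      - h2val q right * a * Real.sinh (a * Real.pi)
      - h2val v right * a ^ 3 * Real.sinh (a * Real.pi) = 0) ∧
    (h2deriv q right * Real.sinh (a * Real.pi)
      - h2val q right * a * Real.cosh (a * Real.pi) + h2val q left * a
      - h2val v right * a ^ 3 * Real.cosh (a * Real.pi) + h2val v left * a ^ 3 = 0) := by
  have hl : ∀ x : ℝ, HasDerivAt (fun x : ℝ => a * x) a x := fun x => by
    simpa using (hasDerivAt_id x).const_mul a
  have d1 : ∀ x : ℝ, HasDerivAt (fun x : ℝ => ((Real.cos (a * x) : ℝ) : ℂ))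
      ((-Real.sin (a * x) * a : ℝ) : ℂ) x := fun x => (hl x).cos.ofReal_comp
  have d2 : ∀ x : ℝ, HasDerivAt (fun x : ℝ => ((Real.sin (a * x) : ℝ) : ℂ))
      ((Real.cos (a * x) * a : ℝ) : ℂ) x := fun x => (hl x).sin.ofReal_comp
  have d3 : ∀ x : ℝ, HasDerivAt (fun x : ℝ => ((Real.cosh (a * x) : ℝ) : ℂ))
      ((Real.sinh (a * x) * a : ℝ) : ℂ) x := fun x => (hl x).cosh.ofReal_comp
  have d4 : ∀ x : ℝ, HasDerivAt (fun x : ℝ => ((Real.sinh (a * x) : ℝ) : ℂ))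
      ((Real.cosh (a * x) * a : ℝ) : ℂ) x := fun x => (hl x).sinh.ofReal_comp
  have k1 := beam_identity hq hq'' h0 hπ (φ := fun x => (Real.cos (a * x) : ℝ))
    (φ₁ := fun x => -a * (Real.sin (a * x) : ℝ)) (φ₂ := fun x => -a ^ 2 * (Real.cos (a * x) : ℝ))
    (φ₃ := fun x => a ^ 3 * (Real.sin (a * x) : ℝ))
    (fun x => (d1 x).congr_deriv (by push_cast; ring))
    (fun x => ((d2 x).const_mul _).congr_deriv (by push_cast; ring))
    (fun x => ((d1 x).const_mul _).congr_deriv (by push_cast; ring))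
    (fun x => ((d2 x).const_mul _).congr_deriv (by push_cast; ring))
  have k2 := beam_identity hq hq'' h0 hπ (φ := fun x => (Real.sin (a * x) : ℝ))
    (φ₁ := fun x => a * (Real.cos (a * x) : ℝ)) (φ₂ := fun x => -a ^ 2 * (Real.sin (a * x) : ℝ))
    (φ₃ := fun x => -a ^ 3 * (Real.cos (a * x) : ℝ))
    (fun x => (d2 x).congr_deriv (by push_cast; ring))
    (fun x => ((d1 x).const_mul _).congr_deriv (by push_cast; ring))
    (fun x => ((d2 x).const_mul _).congr_deriv (by push_cast; ring))
    (fun x => ((d1 x).const_mul _).congr_deriv (by push_cast; ring))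
  have k3 := beam_identity hq hq'' h0 hπ (φ := fun x => (Real.cosh (a * x) : ℝ))
    (φ₁ := fun x => a * (Real.sinh (a * x) : ℝ)) (φ₂ := fun x => a ^ 2 * (Real.cosh (a * x) : ℝ))
    (φ₃ := fun x => a ^ 3 * (Real.sinh (a * x) : ℝ))
    (fun x => (d3 x).congr_deriv (by push_cast; ring))
    (fun x => ((d4 x).const_mul _).congr_deriv (by push_cast; ring))
    (fun x => ((d3 x).const_mul _).congr_deriv (by push_cast; ring))
    (fun x => ((d4 x).const_mul _).congr_deriv (by push_cast; ring))
  have k4 := beam_identity hq hq'' h0 hπ (φ := fun x => (Real.sinh (a * x) : ℝ))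
    (φ₁ := fun x => a * (Real.cosh (a * x) : ℝ)) (φ₂ := fun x => a ^ 2 * (Real.sinh (a * x) : ℝ))
    (φ₃ := fun x => a ^ 3 * (Real.cosh (a * x) : ℝ))
    (fun x => (d4 x).congr_deriv (by push_cast; ring))
    (fun x => ((d3 x).const_mul _).congr_deriv (by push_cast; ring))
    (fun x => ((d4 x).const_mul _).congr_deriv (by push_cast; ring))
    (fun x => ((d3 x).const_mul _).congr_deriv (by push_cast; ring))
  simp only [mul_zero, Real.cos_zero, Real.sin_zero, Real.cosh_zero, Real.sinh_zero,
    Complex.ofReal_zero, Complex.ofReal_one, mul_one, sub_zero] at k1 k2 k3 k4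
  refine ⟨?_, ?_, ?_, ?_⟩
  · linear_combination k1
  · linear_combination k2
  · linear_combination k3
  · linear_combination k4

/-- The element `(0, 0, g, 0)` of the energy space: a force acting on the string only. -/
noncomputable def stringForce (g : L2) : EnergySpace := ((0 : V), g, (0 : L2))

/-- The equation `(𝒜 - i b) y = (0, 0, g, 0)` as a boundary value problem: `U` is `u¹`,
regarded as an element of `H²`, and `q = ∂ₓ²u²`. -/
lemma exists_of_mem_graph {b : ℝ} {g : L2} {y : EnergySpace}
    (h : (y, (Complex.I * b) • y + stringForce g) ∈ op.graph) :
    ∃ U q : H2, h2toH1 U = y.u1 ∧ h2deriv2 U = (-(b : ℂ) ^ 2) • toL2 (h2val U) + g ∧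
      toL2 (h2val q) = h2deriv2 y.u2 ∧ h2deriv2 q = (b : ℂ) ^ 2 • toL2 (h2val y.u2) ∧
      h2deriv q left = h2deriv U left ∧ h2deriv q right = Complex.I * b * h2val y.u2 right ∧
      y.v1 = (Complex.I * b) • toL2 (h2val U) ∧
      y.v2 = (Complex.I * b) • toL2 (h2val y.u2) := by
  obtain ⟨h1, h2, U, q, h3, h4, h5, h6, h7, h8⟩ := mem_graph_iff.1 h
  have e1 : toL2 ((Complex.I * b) • h1val y.u1 + 0) = y.v1 := h1
  have e2 : toL2 ((Complex.I * b) • h2val y.u2 + 0) = y.v2 := h2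
  have e4 : h2deriv2 U = (Complex.I * b) • y.v1 + g := h4
  have e6 : h2deriv2 q = -((Complex.I * b) • y.v2 + 0) := h6
  have e8 : h2deriv q right = Complex.I * b * h2val y.u2 right + 0 := h8
  have eU : h1val y.u1 = h2val U := by rw [← h3]; rfl
  rw [add_zero, map_smul] at e1 e2
  rw [eU] at e1
  have hI : (Complex.I * b) * (Complex.I * b) = -(b : ℂ) ^ 2 := by
    linear_combination (b : ℂ) ^ 2 * Complex.I_sq
  refine ⟨U, q, h3, ?_, h5, ?_, h7, by rw [e8, add_zero], e1.symm, e2.symm⟩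
  · rw [e4, ← e1, smul_smul, hI]
  · rw [e6, add_zero, ← e2, smul_smul, hI, neg_smul, neg_neg]

lemma energy_eq_zero {y : EnergySpace} (h1 : y.u1 = 0) (h2 : y.u2 = 0) (h3 : y.v1 = 0)
    (h4 : y.v2 = 0) : y = 0 := by
  have h := norm_sq_energy y
  rw [h1, h2, h3, h4] at h
  rw [← norm_eq_zero, ← pow_eq_zero_iff two_ne_zero, h]
  change ‖(0 : L2)‖ ^ 2 + ‖(0 : L2)‖ ^ 2 + ‖(0 : L2)‖ ^ 2 + ‖(0 : L2)‖ ^ 2 = 0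
  simp

/-- There are no eigenvalues `i a²`: dissipation makes the beam vanish at `π`, and a beam that is
free of force there is at rest. -/
lemma injective_imaginary {a : ℝ} (ha : 0 < a) (hs : 0 < Real.sin (a * Real.pi))
    {y z : EnergySpace} (h : (y, z) ∈ op.graph)
    (hz : (Complex.I * ((a ^ 2 : ℝ) : ℂ)) • y - z = 0) : y = 0 := by
  have hz' := (sub_eq_zero.1 hz).symm
  subst hz'
  have hd := re_inner_of_mem_graph h
  rw [inner_smul_right, inner_self_eq_norm_sq_to_K] at hd
  have hre : (Complex.I * ((a ^ 2 : ℝ) : ℂ) * ((‖y‖ : ℝ) : ℂ) ^ 2).re = 0 := by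
    rw [show Complex.I * ((a ^ 2 : ℝ) : ℂ) * ((‖y‖ : ℝ) : ℂ) ^ 2
      = ((a ^ 2 * ‖y‖ ^ 2 : ℝ) : ℂ) * Complex.I by push_cast; ring, Complex.re_ofReal_mul,
      Complex.I_re, mul_zero]
  have hw : h2val ((Complex.I * ((a ^ 2 : ℝ) : ℂ)) • y).u2 right = 0 := by
    rw [← norm_eq_zero, ← pow_eq_zero_iff two_ne_zero]
    have := hre.symm.trans hd
    linarith
  have hIa : Complex.I * ((a ^ 2 : ℝ) : ℂ) ≠ 0 :=
    mul_ne_zero Complex.I_ne_zero (by exact_mod_cast (pow_pos ha 2).ne')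
  have hc : h2val y.u2 right = 0 := (mul_eq_zero.1 hw).resolve_left hIa
  obtain ⟨U, q, k1, k2, k3, k4, k5, k6, k7, k8⟩ := exists_of_mem_graph (g := 0) (y := y)
    (b := a ^ 2) (by
      convert h using 2
      exact add_zero _)
  obtain ⟨b1, b2, b3, b4⟩ := boundary_conditions y
  have e4 : (((a ^ 2 : ℝ) : ℂ)) ^ 2 = (a : ℂ) ^ 4 := by push_cast; ring
  rw [e4] at k4
  obtain ⟨r1, r2, r3, r4⟩ := beam_relations k3 k4 b3 b4
  rw [k6, hc] at r1 r2 r3 r4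
  have ha' : (a : ℂ) ≠ 0 := by exact_mod_cast ha.ne'
  have hsh : 0 < Real.sinh (a * Real.pi) := Real.sinh_pos_iff.2 (by positivity)
  have hss : ((Real.sin (a * Real.pi) : ℝ) : ℂ) + (Real.sinh (a * Real.pi) : ℝ) ≠ 0 := by
    exact_mod_cast (add_pos hs hsh).ne'
  have hk1 : h2val q right = 0 := by
    have : h2val q right * (a * (((Real.sin (a * Real.pi) : ℝ) : ℂ)
        + (Real.sinh (a * Real.pi) : ℝ))) = 0 := by linear_combination r1 - r3
    exact (mul_eq_zero.1 this).resolve_right (mul_ne_zero ha' hss)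
  rw [hk1] at r1 r2 r4
  have hP : h2deriv q left = 0 := by linear_combination -r1
  have hk0 : h2val q left = 0 := by
    have : h2val q left * (2 * a) = 0 := by linear_combination r2 + r4
    exact (mul_eq_zero.1 this).resolve_right (mul_ne_zero two_ne_zero ha')
  have hb : h2val y.u2 left = 0 := by
    have : h2val y.u2 left * (2 * a ^ 3) = 0 := by linear_combination r4 - r2
    exact (mul_eq_zero.1 this).resolve_right (mul_ne_zero two_ne_zero (pow_ne_zero 3 ha'))
  have hU : U = 0 := by
    refine eq_zero_of_second_order (k := Complex.I * ((a ^ 2 : ℝ) : ℂ)) ?_ (k5.symm.trans hP) ?_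
    · have : h2val U left = h1val y.u1 left := by rw [← k1]; rfl
      rw [this, b2, hb]
    · rw [k2, add_zero, mul_pow, Complex.I_sq, neg_one_mul]
  -- `∂⁴ - a⁴ = (∂² + a²) (∂² - a²)`, and all Cauchy data at `0` vanish
  have hw : q - (a : ℂ) ^ 2 • y.u2 = 0 := by
    refine eq_zero_of_second_order (k := Complex.I * a) ?_ ?_ ?_
    · change h2val q left - (a : ℂ) ^ 2 * h2val y.u2 left = 0
      rw [hk0, hb, mul_zero, sub_zero]
    · change h2deriv q left - (a : ℂ) ^ 2 * h2deriv y.u2 left = 0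
      rw [hP, b3, mul_zero, sub_zero]
    · change h2deriv2 q - (a : ℂ) ^ 2 • h2deriv2 y.u2
        = (Complex.I * a) ^ 2 • toL2 (h2val q - (a : ℂ) ^ 2 • h2val y.u2)
      rw [k4, ← k3, map_sub, map_smul, mul_pow, Complex.I_sq]
      module
  have hv : y.u2 = 0 := by
    refine eq_zero_of_second_order (k := a) hb b3 ?_
    have hq : q = (a : ℂ) ^ 2 • y.u2 := sub_eq_zero.1 hw
    rw [← k3, hq]
    exact map_smul toL2 _ _
  refine energy_eq_zero ?_ hv ?_ ?_
  · rw [← k1, hU]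
    exact h1_eq_zero rfl
  · rw [k7, hU]
    change _ • toL2 0 = 0
    rw [map_zero, smul_zero]
  · rw [k8, hv]
    change _ • toL2 0 = 0
    rw [map_zero, smul_zero]

/-! ### Growth of the solutions along the resonant frequencies -/

lemma norm_toL2_le {F : Cont} (h : ∀ x, ‖F x‖ ≤ 1) : ‖toL2 F‖ ≤ 2 := by
  have h1 : inner ℂ (toL2 F) (toL2 F)
      = ∫ x in (0 : ℝ)..Real.pi, starRingEnd ℂ (ext F x) * ext F x := by
    rw [inner_toL2_left]
    refine integral_congr_pi ?_
    filter_upwards [toL2_coe F] with x hx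
    rw [hx]
  have hF : ∀ x, ‖ext F x‖ ≤ 1 := fun x => h _
  have h2 : ‖(inner ℂ (toL2 F) (toL2 F) : ℂ)‖ ≤ 1 * |Real.pi - 0| := by
    rw [h1]
    refine intervalIntegral.norm_integral_le_of_norm_le_const fun x _ => ?_
    rw [norm_mul, RCLike.norm_conj]
    exact mul_le_one₀ (hF x) (norm_nonneg _) (hF x)
  rw [inner_self_eq_norm_sq_to_K, sub_zero, one_mul, abs_of_pos Real.pi_pos, norm_pow,
    RCLike.norm_ofReal, abs_of_nonneg (norm_nonneg _)] at h2
  nlinarith [Real.pi_le_four, norm_nonneg (toL2 F)]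

lemma norm_left_le {f : H1} (h : h1val f right = 0) : ‖h1val f left‖ ≤ 2 * ‖h1deriv f‖ := by
  have h1 := h1_isPrimitive f right
  rw [h, ← inner_one, eq_comm, ← eq_neg_iff_add_eq_zero] at h1
  rw [h1, norm_neg]
  refine (norm_inner_le_norm _ _).trans ?_
  gcongr
  exact norm_toL2_le fun x => by simp

lemma ext_sinFun (b : ℝ) {x : ℝ} (hx : x ∈ Icc 0 Real.pi) :
    ext (sinFun b) x = (Real.sin (b * x) : ℝ) := ext_coe (sinFun b) ⟨x, hx⟩

lemma norm_toL2_sinFun_le (b : ℝ) : ‖toL2 (sinFun b)‖ ≤ 2 := norm_toL2_le fun x => by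
  change ‖((Real.sin (b * x) : ℝ) : ℂ)‖ ≤ 1
  rw [Complex.norm_real]
  exact Real.abs_sin_le_one _

/-- Green's identity for the forced string. -/
lemma string_identity {U : H2} {b : ℝ}
    (hU : h2deriv2 U = (-(b : ℂ) ^ 2) • toL2 (h2val U) + -toL2 (sinFun b))
    (hπ : h2val U right = 0) {φ φ' ψ : ℝ → ℂ} (h : ∀ x, HasDerivAt φ (φ' x) x)
    (h' : ∀ x, HasDerivAt φ' (ψ x - b ^ 2 * φ x) x) (hψ : Continuous ψ) :
    h2deriv U right * φ Real.pi - h2deriv U left * φ 0 + h2val U left * φ' 0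
      + ∫ x in (0 : ℝ)..Real.pi, ext (h2val U) x * ψ x
      = -∫ x in (0 : ℝ)..Real.pi, (Real.sin (b * x) : ℝ) * φ x := by
  have hφ : Continuous φ := continuous_iff_continuousAt.2 fun x => (h x).continuousAt
  have hc := ext_continuous (h2val U)
  have e1 := green U h h' (by fun_prop)
  have e2 : ∫ x in (0 : ℝ)..Real.pi, h2deriv2 U x * φ x
      = (∫ x in (0 : ℝ)..Real.pi, (-(b : ℂ) ^ 2) * (ext (h2val U) x * φ x))
        - ∫ x in (0 : ℝ)..Real.pi, ((Real.sin (b * x) : ℝ) : ℂ) * φ x := by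
    rw [← intervalIntegral.integral_sub
      (Continuous.intervalIntegrable (by fun_prop) _ _)
      (Continuous.intervalIntegrable (by fun_prop) _ _), hU]
    refine integral_congr_pi ?_
    have hm : ∀ᵐ x ∂vol, x ∈ Ioo 0 Real.pi := ae_restrict_mem measurableSet_Ioo
    filter_upwards [Lp.coeFn_add ((-(b : ℂ) ^ 2) • toL2 (h2val U)) (-toL2 (sinFun b)),
      Lp.coeFn_smul (-(b : ℂ) ^ 2) (toL2 (h2val U)), Lp.coeFn_neg (toL2 (sinFun b)),
      toL2_coe (h2val U), toL2_coe (sinFun b), hm] with x h1 h2 h3 h4 h5 hx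
    rw [h1, Pi.add_apply, h2, Pi.smul_apply, h3, Pi.neg_apply, h4, h5,
      ext_sinFun b ⟨hx.1.le, hx.2.le⟩, smul_eq_mul]
    ring
  have e3 : ∫ x in (0 : ℝ)..Real.pi, ext (h2val U) x * (ψ x - b ^ 2 * φ x)
      = (∫ x in (0 : ℝ)..Real.pi, ext (h2val U) x * ψ x)
        + ∫ x in (0 : ℝ)..Real.pi, (-(b : ℂ) ^ 2) * (ext (h2val U) x * φ x) := by
    rw [← intervalIntegral.integral_add
      (Continuous.intervalIntegrable (by fun_prop) _ _)
      (Continuous.intervalIntegrable (by fun_prop) _ _)]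
    exact integral_congr_Icc fun x _ => by ring
  rw [e2, e3, hπ] at e1
  linear_combination -e1

lemma integral_sin_mul_sin_sub {b : ℝ} (hb : b ≠ 0) :
    ∫ x in (0 : ℝ)..Real.pi, Real.sin (b * x) * Real.sin (b * (Real.pi - x))
      = Real.sin (b * Real.pi) / (2 * b) - Real.pi / 2 * Real.cos (b * Real.pi) := by
  have hd : ∀ x : ℝ, HasDerivAt (fun x : ℝ => Real.sin (2 * b * x - b * Real.pi) / (4 * b)
      - x / 2 * Real.cos (b * Real.pi)) (Real.sin (b * x) * Real.sin (b * (Real.pi - x))) x := by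
    intro x
    have h1 : HasDerivAt (fun x : ℝ => 2 * b * x - b * Real.pi) (2 * b) x := by
      simpa using ((hasDerivAt_id x).const_mul (2 * b)).sub_const (b * Real.pi)
    have h2 := (h1.sin.div_const (4 * b)).fun_sub
      (((hasDerivAt_id x).div_const 2).mul_const (Real.cos (b * Real.pi)))
    refine h2.congr_deriv ?_
    have e1 : Real.cos (2 * b * x - b * Real.pi)
        = Real.cos (b * x - b * (Real.pi - x)) := by congr 1; ring
    have e2 : Real.cos (b * Real.pi) = Real.cos (b * x + b * (Real.pi - x)) := by congr 1; ring
    rw [e1, e2, Real.cos_sub, Real.cos_add]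
    field_simp
    ring
  rw [intervalIntegral.integral_eq_sub_of_hasDerivAt (fun x _ => hd x)
    (Continuous.intervalIntegrable (by fun_prop) _ _)]
  have e1 : 2 * b * Real.pi - b * Real.pi = b * Real.pi := by ring
  have e2 : 2 * b * 0 - b * Real.pi = -(b * Real.pi) := by ring
  rw [e1, e2, Real.sin_neg]
  field_simp
  ring

/-- The relation between `u(0)` and `u'(0)` along the forced string. -/
lemma string_relation {U : H2} {b : ℝ} (hb : b ≠ 0)
    (hU : h2deriv2 U = (-(b : ℂ) ^ 2) • toL2 (h2val U) + -toL2 (sinFun b))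
    (hπ : h2val U right = 0) :
    h2deriv U left * Real.sin (b * Real.pi) + h2val U left * (b * Real.cos (b * Real.pi))
      = ((Real.sin (b * Real.pi) / (2 * b) - Real.pi / 2 * Real.cos (b * Real.pi) : ℝ) : ℂ) := by
  have hl : ∀ x : ℝ, HasDerivAt (fun x : ℝ => b * (Real.pi - x)) (-b) x := fun x => by
    simpa using ((hasDerivAt_id x).const_sub Real.pi).const_mul b
  -- this test function solves the free equation and vanishes at `π`, where `u'` is not known
  have h := string_identity hU hπ (φ := fun x => ((Real.sin (b * (Real.pi - x)) : ℝ) : ℂ))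
    (φ' := fun x => ((-(b * Real.cos (b * (Real.pi - x))) : ℝ) : ℂ)) (ψ := fun _ => 0)
    (fun x => (hl x).sin.ofReal_comp.congr_deriv (by push_cast; ring))
    (fun x => ((hl x).cos.const_mul b).fun_neg.ofReal_comp.congr_deriv (by push_cast; ring))
    continuous_const
  have hI : ∫ x in (0 : ℝ)..Real.pi,
      ((Real.sin (b * x) : ℝ) : ℂ) * ((Real.sin (b * (Real.pi - x)) : ℝ) : ℂ)
      = ((Real.sin (b * Real.pi) / (2 * b) - Real.pi / 2 * Real.cos (b * Real.pi) : ℝ) : ℂ) := by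
    rw [← integral_sin_mul_sin_sub hb, ← intervalIntegral.integral_ofReal]
    exact integral_congr_Icc fun x _ => by push_cast; ring
  rw [hI] at h
  simp only [sub_self, mul_zero, Real.sin_zero, sub_zero, intervalIntegral.integral_zero,
    add_zero, Complex.ofReal_zero] at h
  push_cast at h ⊢
  linear_combination -h

/-- The tension of the string at the joint is controlled by the energy. -/
lemma norm_tension_le {y : EnergySpace} {U : H2} {b : ℝ} (hy : h2toH1 U = y.u1)
    (hv : y.v1 = (Complex.I * b) • toL2 (h2val U))
    (hU : h2deriv2 U = (-(b : ℂ) ^ 2) • toL2 (h2val U) + -toL2 (sinFun b)) :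
    Real.pi * ‖h2deriv U left‖ ≤ 6 * ‖y‖ + 16 := by
  have hπ : h2val U right = 0 := by
    have := (boundary_conditions y).1
    rw [← hy] at this
    exact this
  have hl : ∀ x : ℝ, HasDerivAt (fun x : ℝ => b * x) b x := fun x => by
    simpa using (hasDerivAt_id x).const_mul b
  have hm : ∀ x : ℝ, HasDerivAt (fun x : ℝ => Real.pi - x) (-1) x := fun x =>
    (hasDerivAt_id x).const_sub Real.pi
  -- the test function `φ = (π - x) cos (b x)` vanishes at `π` and is resonant:
  -- `φ'' + b² φ = 2 b sin (b x)`, which pairs with `b u` to an inner product with `v¹`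
  have h := string_identity hU hπ
    (φ := fun x => (((Real.pi - x) * Real.cos (b * x) : ℝ) : ℂ))
    (φ' := fun x => ((-Real.cos (b * x) - b * ((Real.pi - x) * Real.sin (b * x)) : ℝ) : ℂ))
    (ψ := fun x => ((2 * b * Real.sin (b * x) : ℝ) : ℂ))
    (fun x => ((hm x).fun_mul (hl x).cos).ofReal_comp.congr_deriv (by push_cast; ring))
    (fun x => ((hl x).cos.fun_neg.fun_sub
      (((hm x).fun_mul (hl x).sin).const_mul b)).ofReal_comp.congr_deriv (by push_cast; ring))
    (by fun_prop)
  simp only [sub_self, mul_zero, zero_mul, sub_zero, Real.cos_zero, Real.sin_zero, mul_one,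
    Complex.ofReal_zero, zero_sub] at h
  have e1 : inner ℂ (toL2 (sinFun b)) y.v1
      = Complex.I * b * ∫ x in (0 : ℝ)..Real.pi, ext (h2val U) x * ((Real.sin (b * x) : ℝ) : ℂ) := by
    rw [inner_toL2_left, hv, ← integral_toL2_smul_mul]
    refine integral_congr_Icc fun x hx => ?_
    rw [ext_sinFun b hx, Complex.conj_ofReal, mul_comm]
  have e2 : ∫ x in (0 : ℝ)..Real.pi, ext (h2val U) x * ((2 * b * Real.sin (b * x) : ℝ) : ℂ)
      = -2 * Complex.I * inner ℂ (toL2 (sinFun b)) y.v1 := by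
    have : ∫ x in (0 : ℝ)..Real.pi, ext (h2val U) x * ((2 * b * Real.sin (b * x) : ℝ) : ℂ)
      = 2 * b * ∫ x in (0 : ℝ)..Real.pi, ext (h2val U) x * ((Real.sin (b * x) : ℝ) : ℂ) := by
      rw [← intervalIntegral.integral_const_mul]
      exact integral_congr_Icc fun x _ => by push_cast; ring
    rw [this, e1]
    linear_combination (2 * b * ∫ x in (0 : ℝ)..Real.pi,
      ext (h2val U) x * ((Real.sin (b * x) : ℝ) : ℂ)) * Complex.I_sq
  have n1 : ‖(inner ℂ (toL2 (sinFun b)) y.v1 : ℂ)‖ ≤ 2 * ‖y‖ :=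
    (norm_inner_le_norm _ _).trans (mul_le_mul (norm_toL2_sinFun_le b)
      (norm_components_le y).2.2.1 (norm_nonneg _) zero_le_two)
  have n2 : ‖h2val U left‖ ≤ 2 * ‖y‖ := by
    have h1 := norm_left_le (f := h2toH1 U) hπ
    have h2 := (norm_components_le y).1
    rw [← hy] at h2
    exact h1.trans (by linarith)
  have n3 : ‖∫ x in (0 : ℝ)..Real.pi, ((Real.sin (b * x) : ℝ) : ℂ)
      * (((Real.pi - x) * Real.cos (b * x) : ℝ) : ℂ)‖ ≤ Real.pi * |Real.pi - 0| := by
    refine intervalIntegral.norm_integral_le_of_norm_le_const fun x hx => ?_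
    rw [uIoc_of_le Real.pi_pos.le] at hx
    rw [norm_mul, Complex.norm_real, Complex.norm_real, norm_mul, Real.norm_eq_abs,
      Real.norm_eq_abs, Real.norm_eq_abs]
    have a1 := Real.abs_sin_le_one (b * x)
    have a2 := Real.abs_cos_le_one (b * x)
    have a3 : |Real.pi - x| ≤ Real.pi := by
      rw [abs_of_nonneg (sub_nonneg.2 hx.2)]
      linarith [hx.1]
    calc |Real.sin (b * x)| * (|Real.pi - x| * |Real.cos (b * x)|)
        ≤ 1 * (Real.pi * 1) := by gcongr
      _ = Real.pi := by ring
  rw [sub_zero, abs_of_pos Real.pi_pos] at n3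
  rw [e2] at h
  have e3 : (Real.pi : ℂ) * h2deriv U left = -h2val U left
      - 2 * Complex.I * inner ℂ (toL2 (sinFun b)) y.v1
      + ∫ x in (0 : ℝ)..Real.pi, ((Real.sin (b * x) : ℝ) : ℂ)
      * (((Real.pi - x) * Real.cos (b * x) : ℝ) : ℂ) := by
    push_cast at h ⊢
    linear_combination -h
  have e4 : ‖(Real.pi : ℂ) * h2deriv U left‖ = Real.pi * ‖h2deriv U left‖ := by
    rw [norm_mul, Complex.norm_real, Real.norm_of_nonneg Real.pi_pos.le]
  rw [← e4, e3]
  have n4 : ‖2 * Complex.I * (inner ℂ (toL2 (sinFun b)) y.v1 : ℂ)‖ ≤ 4 * ‖y‖ := by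
    rw [norm_mul, norm_mul, Complex.norm_I, Complex.norm_two]
    linarith
  refine (norm_add_le _ _).trans ?_
  have n5 := norm_sub_le (-h2val U left) (2 * Complex.I * inner ℂ (toL2 (sinFun b)) y.v1)
  rw [norm_neg] at n5
  nlinarith [Real.pi_le_four, Real.pi_pos]

/-! ### The resonant frequencies -/

lemma sin_cos_of_even {m : ℕ} (hm : 0 < m) (he : Even m) :
    Real.sin (((m : ℝ) ^ 2 + 1 / m) * Real.pi) = Real.sin (Real.pi / m) ∧
    Real.sin (((m : ℝ) ^ 2 + 1 / m) ^ 2 * Real.pi) = Real.sin (Real.pi / m ^ 2) ∧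
    Real.cos (((m : ℝ) ^ 2 + 1 / m) ^ 2 * Real.pi) = Real.cos (Real.pi / m ^ 2) := by
  obtain ⟨k, rfl⟩ := he
  have hk : (k : ℝ) ≠ 0 := by
    have : 0 < k := by omega
    exact_mod_cast this.ne'
  have e1 : (((k + k : ℕ) : ℝ) ^ 2 + 1 / (k + k : ℕ)) * Real.pi
      = Real.pi / (k + k : ℕ) + (2 * k ^ 2 : ℕ) * (2 * Real.pi) := by
    push_cast
    field_simp
    ring
  have e2 : (((k + k : ℕ) : ℝ) ^ 2 + 1 / (k + k : ℕ)) ^ 2 * Real.pi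
      = Real.pi / (k + k : ℕ) ^ 2 + (8 * k ^ 4 + 2 * k : ℕ) * (2 * Real.pi) := by
    push_cast
    field_simp
    ring
  rw [e1, e2, Real.sin_add_nat_mul_two_pi, Real.sin_add_nat_mul_two_pi,
    Real.cos_add_nat_mul_two_pi]
  exact ⟨rfl, rfl, rfl⟩

lemma beta_sq (m : ℕ) (hm : 0 < m) : beta (m ^ 2) = ((m : ℝ) ^ 2 + 1 / m) ^ 2 := by
  have hm' : (m : ℝ) ≠ 0 := by exact_mod_cast hm.ne'
  rw [beta, Nat.cast_pow, Real.sqrt_sq (Nat.cast_nonneg m)]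
  field_simp
  ring

/-- For `v'''' = a⁴ v` with the feedback at `π`, the displacement at the joint is small compared to
the force `P = v'''(0)` there. The values at `a π` of `1 / sin + 1 / sinh` and `cot + coth` are bounded
by `M` and `2 M`; `Q = v'''(π)`, `k₀ = v''(0)`, `k₁ = v''(π)`, `c = v(π)`, `b = v(0)`. -/
lemma norm_joint_le {Q P k₀ k₁ c b : ℂ} {a s co sh ch M : ℝ} (hs : 0 < s) (hsh : 0 < sh)
    (hM : 1 ≤ M) (ha : M ^ 2 ≤ a) (hcs : s ^ 2 + co ^ 2 = 1) (hch : ch ^ 2 - sh ^ 2 = 1)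
    (hσ : 1 / s + 1 / sh ≤ M) (hκ : |co / s + ch / sh| ≤ 2 * M)
    (hQ : Q = Complex.I * (a : ℂ) ^ 2 * c)
    (r1 : Q * co - P + k₁ * a * s - c * a ^ 3 * s = 0)
    (r2 : Q * s - k₁ * a * co + k₀ * a + c * a ^ 3 * co - b * a ^ 3 = 0)
    (r3 : Q * ch - P - k₁ * a * sh - c * a ^ 3 * sh = 0)
    (r4 : Q * sh - k₁ * a * ch + k₀ * a - c * a ^ 3 * ch + b * a ^ 3 = 0) :
    a ^ 2 * ‖b‖ ≤ 3 / (2 * M) * ‖P‖ := by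
  have hM0 : 0 < M := by linarith
  have ha0 : 0 < a := by nlinarith
  have hs' : (s : ℂ) ≠ 0 := by exact_mod_cast hs.ne'
  have hsh' : (sh : ℂ) ≠ 0 := by exact_mod_cast hsh.ne'
  have hcs' : (s : ℂ) ^ 2 + (co : ℂ) ^ 2 = 1 := by exact_mod_cast hcs
  have hch' : (ch : ℂ) ^ 2 - (sh : ℂ) ^ 2 = 1 := by exact_mod_cast hch
  set σ : ℝ := 1 / s + 1 / sh with hσdef
  set κ : ℝ := co / s + ch / sh with hκdef
  have hσ0 : 0 < σ := by positivity
  -- the combination with `φ = cos (a x) / sin (a π) + cosh (a x) / sinh (a π)`, for which `φ'` is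
  -- zero at both ends and `φ'''(0) = 0`
  have e1 : c * (Complex.I * (a : ℂ) ^ 2 * κ - 2 * (a : ℂ) ^ 3) = P * σ := by
    have : Q * κ - P * σ - 2 * a ^ 3 * c = 0 := by
      have h1 : Q * κ - P * σ - 2 * a ^ 3 * c
        = (Q * co - P + k₁ * a * s - c * a ^ 3 * s) / s
          + (Q * ch - P - k₁ * a * sh - c * a ^ 3 * sh) / sh := by
        rw [hσdef, hκdef]
        push_cast
        field_simp
        ring
      rw [h1, r1, r3]
      simp
    rw [hQ] at this
    linear_combination this
  -- the combination with the reflection `φ (π - x)`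
  have e2 : 2 * (a : ℂ) ^ 3 * b = Complex.I * (a : ℂ) ^ 2 * c * σ - P * κ := by
    have h1 : (Q * co - P + k₁ * a * s - c * a ^ 3 * s) * co / s
        + (Q * s - k₁ * a * co + k₀ * a + c * a ^ 3 * co - b * a ^ 3)
        + (Q * ch - P - k₁ * a * sh - c * a ^ 3 * sh) * ch / sh
        - (Q * sh - k₁ * a * ch + k₀ * a - c * a ^ 3 * ch + b * a ^ 3)
        = Q * (((s : ℂ) ^ 2 + (co : ℂ) ^ 2) / s + ((ch : ℂ) ^ 2 - (sh : ℂ) ^ 2) / sh)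
          - P * κ - 2 * a ^ 3 * b := by
      rw [hκdef]
      push_cast
      field_simp
      ring
    rw [r1, r2, r3, r4, hcs', hch'] at h1
    rw [hQ] at h1
    rw [hσdef]
    push_cast
    linear_combination h1
  have n1 : 2 * a ^ 3 * ‖c‖ ≤ ‖P‖ * M := by
    -- `κ` is real, so it contributes to the imaginary part only
    have h1 : 2 * a ^ 3 ≤ ‖Complex.I * (a : ℂ) ^ 2 * κ - 2 * (a : ℂ) ^ 3‖ := by
      have h2 := Complex.abs_re_le_norm (Complex.I * (a : ℂ) ^ 2 * κ - 2 * (a : ℂ) ^ 3)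
      have h3 : Complex.I * (a : ℂ) ^ 2 * κ - 2 * (a : ℂ) ^ 3
          = ((-(2 * a ^ 3) : ℝ) : ℂ) + ((a ^ 2 * κ : ℝ) : ℂ) * Complex.I := by push_cast; ring
      have h4 : (Complex.I * (a : ℂ) ^ 2 * κ - 2 * (a : ℂ) ^ 3).re = -(2 * a ^ 3) := by
        rw [h3, Complex.add_re, Complex.ofReal_re, Complex.re_ofReal_mul, Complex.I_re, mul_zero,
          add_zero]
      rwa [h4, abs_neg, abs_of_pos (by positivity)] at h2
    have h2 := congrArg norm e1
    rw [norm_mul, norm_mul, Complex.norm_real, Real.norm_of_nonneg hσ0.le] at h2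
    calc 2 * a ^ 3 * ‖c‖
        ≤ ‖Complex.I * (a : ℂ) ^ 2 * κ - 2 * (a : ℂ) ^ 3‖ * ‖c‖ := by gcongr
      _ = ‖P‖ * σ := by rw [mul_comm, h2]
      _ ≤ ‖P‖ * M := by gcongr
  have n2 : 2 * a ^ 3 * ‖b‖ ≤ a ^ 2 * ‖c‖ * M + ‖P‖ * (2 * M) := by
    have h2 := congrArg norm e2
    have h3 : ‖2 * (a : ℂ) ^ 3 * b‖ = 2 * a ^ 3 * ‖b‖ := by
      rw [norm_mul, norm_mul, norm_pow, Complex.norm_real, Real.norm_of_nonneg ha0.le,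
        Complex.norm_two]
    have h4 : ‖Complex.I * (a : ℂ) ^ 2 * c * σ‖ = a ^ 2 * ‖c‖ * σ := by
      rw [norm_mul, norm_mul, norm_mul, norm_pow, Complex.norm_real, Complex.norm_real,
        Real.norm_of_nonneg ha0.le, Real.norm_of_nonneg hσ0.le, Complex.norm_I, one_mul]
    have h5 : ‖P * (κ : ℂ)‖ = ‖P‖ * |κ| := by rw [norm_mul, Complex.norm_real, Real.norm_eq_abs]
    rw [← h3, h2]
    refine (norm_sub_le _ _).trans ?_
    rw [h4, h5]
    gcongr
  have n3 : a ^ 2 * ‖c‖ * M ≤ ‖P‖ / 2 := by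
    have h1 : a ^ 2 * ‖c‖ * M * a ≤ ‖P‖ / 2 * a := by
      calc a ^ 2 * ‖c‖ * M * a = 2 * a ^ 3 * ‖c‖ * (M / 2) := by ring
        _ ≤ ‖P‖ * M * (M / 2) := by gcongr
        _ = ‖P‖ / 2 * M ^ 2 := by ring
        _ ≤ ‖P‖ / 2 * a := by gcongr
    exact le_of_mul_le_mul_right h1 ha0
  have n4 : 2 * a * (a ^ 2 * ‖b‖) ≤ 3 * M * ‖P‖ := by nlinarith [norm_nonneg P]
  have n5 : a ^ 2 * ‖b‖ * (2 * M ^ 2) ≤ 3 * M * ‖P‖ := by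
    refine le_trans ?_ n4
    have : 0 ≤ a ^ 2 * ‖b‖ := by positivity
    nlinarith
  rw [div_mul_eq_mul_div, le_div_iff₀ (by positivity)]
  nlinarith

/-- Jordan's inequality at `π / m`. -/
lemma two_div_le_sin {m : ℝ} (hm : 2 ≤ m) : 2 / m ≤ Real.sin (Real.pi / m) := by
  have h1 := Real.mul_le_sin (x := Real.pi / m) (by positivity) (by gcongr)
  refine le_trans (le_of_eq ?_) h1
  field_simp

/-- Bounds for `1 / sin + 1 / sinh` and `cot + coth`. -/
lemma abs_cot_add_coth_le {s co sh ch M : ℝ} (hs : 2 / M ≤ s) (hM : 2 ≤ M) (hsh : 1 ≤ sh)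
    (hcs : s ^ 2 + co ^ 2 = 1) (hch : ch ^ 2 - sh ^ 2 = 1) (hch0 : 0 < ch) :
    1 / s + 1 / sh ≤ M ∧ |co / s + ch / sh| ≤ 2 * M := by
  have hs0 : 0 < s := lt_of_lt_of_le (by positivity) hs
  have h1 : 1 / s ≤ M / 2 := by
    rw [div_le_div_iff₀ hs0 two_pos]
    rw [div_le_iff₀ (by linarith)] at hs
    linarith
  have h2 : 1 / sh ≤ 1 := by
    rw [div_le_one (by linarith)]
    exact hsh
  have h3 : |co / s| ≤ M / 2 := by
    rw [abs_div, abs_of_pos hs0]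
    refine le_trans ?_ h1
    gcongr
    rw [abs_le_one_iff_mul_self_le_one]
    nlinarith
  have h4 : |ch / sh| ≤ 2 := by
    rw [abs_of_pos (by positivity), div_le_iff₀ (by linarith)]
    nlinarith
  refine ⟨by linarith, (abs_add_le _ _).trans (by linarith)⟩

/-- The force at the joint is large: the string is driven near an eigenvalue of the clamped string
(`sin (b π) = sin (π / M²)` is small), and the displacement `u` of the joint is small too. -/
lemma le_norm_of_relation {P u : ℂ} {M b : ℝ} (hM : 2 ≤ M) (hb : 16 ≤ b)
    (hu : b * ‖u‖ ≤ 3 / (2 * M) * ‖P‖)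
    (h : P * Real.sin (Real.pi / M ^ 2) + u * (b * Real.cos (Real.pi / M ^ 2))
      = ((Real.sin (Real.pi / M ^ 2) / (2 * b)
        - Real.pi / 2 * Real.cos (Real.pi / M ^ 2) : ℝ) : ℂ)) : M / 8 ≤ ‖P‖ := by
  have hM0 : 0 < M := by linarith
  have hb0 : 0 < b := by linarith
  have hx0 : 0 < Real.pi / M ^ 2 := by positivity
  have hx1 : Real.pi / M ^ 2 ≤ 4 / (2 * M) := by
    rw [div_le_div_iff₀ (by positivity) (by positivity)]
    nlinarith [Real.pi_le_four, Real.pi_pos]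
  have hx2 : Real.pi / M ^ 2 ≤ 0.8 := by
    rw [div_le_iff₀ (by positivity)]
    nlinarith [Real.pi_lt_d2]
  obtain ⟨x, hx⟩ : ∃ x, x = Real.pi / M ^ 2 := ⟨_, rfl⟩
  rw [← hx] at hx0 hx1 hx2 h
  have hs1 : Real.sin x ≤ x := Real.sin_le hx0.le
  have hs0 : 0 ≤ Real.sin x :=
    Real.sin_nonneg_of_nonneg_of_le_pi hx0.le (by linarith [Real.pi_gt_three])
  have hc0 : 0.6 ≤ Real.cos x := by
    have := Real.one_sub_sq_div_two_le_cos (x := x)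
    nlinarith
  have hc1 := Real.cos_le_one x
  have hI : 1 / 2 ≤ ‖((Real.sin x / (2 * b) - Real.pi / 2 * Real.cos x : ℝ) : ℂ)‖ := by
    rw [Complex.norm_real, Real.norm_eq_abs, abs_sub_comm]
    refine le_trans ?_ (le_abs_self _)
    have h1 : Real.sin x / (2 * b) ≤ 1 / 32 := by
      rw [div_le_div_iff₀ (by positivity) (by positivity)]
      linarith
    have h2 : 3 / 2 * 0.6 ≤ Real.pi / 2 * Real.cos x := by
      gcongr
      exact Real.pi_gt_three.le
    linarith
  have n1 : ‖P * (Real.sin x : ℂ)‖ ≤ ‖P‖ * (4 / (2 * M)) := by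
    rw [norm_mul, Complex.norm_real, Real.norm_of_nonneg hs0]
    gcongr
    exact hs1.trans hx1
  have n2 : ‖u * ((b : ℂ) * (Real.cos x : ℂ))‖ ≤ 3 / (2 * M) * ‖P‖ := by
    rw [norm_mul, norm_mul, Complex.norm_real, Complex.norm_real, Real.norm_of_nonneg hb0.le,
      Real.norm_of_nonneg (by linarith : 0 ≤ Real.cos x)]
    refine le_trans ?_ hu
    rw [mul_left_comm, ← mul_assoc]
    exact (mul_le_of_le_one_right (by positivity) hc1)
  rw [← h] at hI
  have h1 := hI.trans (norm_add_le _ _)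
  have h2 : 1 / 2 ≤ 7 * ‖P‖ / (2 * M) := by
    calc 1 / 2 ≤ ‖P‖ * (4 / (2 * M)) + 3 / (2 * M) * ‖P‖ := by linarith
      _ = 7 * ‖P‖ / (2 * M) := by ring
  rw [le_div_iff₀ (by positivity)] at h2
  linarith [norm_nonneg P]

/-- The solutions grow: with `m = √n`, the tension at the joint is at least `m / 8`. -/
lemma le_norm_solution {m : ℕ} (hm : 0 < m) (he : Even m) {y : EnergySpace}
    (h : (y, (Complex.I * (beta (m ^ 2) : ℂ)) • y + forcing (m ^ 2)) ∈ op.graph) :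
    (Real.pi * (m / 8) - 16) / 6 ≤ ‖y‖ := by
  have hm2 : (2 : ℝ) ≤ m := by
    obtain ⟨k, rfl⟩ := he
    have : 2 ≤ k + k := by omega
    exact_mod_cast this
  obtain ⟨t1, t2, t3⟩ := sin_cos_of_even hm he
  rw [← beta_sq m hm] at t2 t3
  have hβ := beta_sq m hm
  set M : ℝ := (m : ℝ) with hM
  set a : ℝ := M ^ 2 + 1 / M with ha
  set b : ℝ := beta (m ^ 2) with hb
  have ha1 : M ^ 2 ≤ a := by
    rw [ha]
    have : 0 ≤ 1 / M := by positivity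
    linarith
  have ha4 : 4 ≤ a := by nlinarith
  have hb16 : 16 ≤ b := by nlinarith
  obtain ⟨U, q, k1, k2, k3, k4, k5, k6, k7, k8⟩ :=
    exists_of_mem_graph (g := -toL2 (sinFun b)) h
  obtain ⟨b1, b2, b3, b4⟩ := boundary_conditions y
  have e4 : (b : ℂ) ^ 2 = (a : ℂ) ^ 4 := by
    rw [hβ]
    push_cast
    ring
  have e2 : (b : ℂ) = (a : ℂ) ^ 2 := by
    rw [hβ]
    push_cast
    rfl
  rw [e4] at k4
  rw [e2] at k6
  obtain ⟨r1, r2, r3, r4⟩ := beam_relations k3 k4 b3 b4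
  have hsin := two_div_le_sin hm2
  rw [← t1] at hsin
  have hs0 : 0 < Real.sin (a * Real.pi) := lt_of_lt_of_le (by positivity) hsin
  have hsh : 1 ≤ Real.sinh (a * Real.pi) := by
    have h1 : a * Real.pi ≤ Real.sinh (a * Real.pi) := Real.self_le_sinh_iff.2 (by positivity)
    nlinarith [Real.pi_gt_three]
  have hcs := Real.sin_sq_add_cos_sq (a * Real.pi)
  have hch := Real.cosh_sq_sub_sinh_sq (a * Real.pi)
  obtain ⟨hσ, hκ⟩ := abs_cot_add_coth_le hsin hm2 hsh hcs hch (Real.cosh_pos _)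
  have hjoint := norm_joint_le hs0 (by linarith) (by linarith) ha1 hcs hch hσ hκ k6 r1 r2 r3 r4
  have hUπ : h2val U right = 0 := by
    rw [← k1] at b1
    exact b1
  have hU0 : h2val U left = h2val y.u2 left := by
    rw [← b2, ← k1]
    rfl
  have hrel := string_relation (by linarith : b ≠ 0) k2 hUπ
  rw [t2, t3, hU0, ← k5] at hrel
  rw [← hβ] at hjoint
  have hPm := le_norm_of_relation hm2 hb16 hjoint hrel
  have hten := norm_tension_le k1 k7 k2
  rw [← k5] at hten
  have h2 : Real.pi * (M / 8) ≤ Real.pi * ‖h2deriv q left‖ := by gcongr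
  linarith

/-! ### The resolvent at the resonant frequencies -/

lemma injective_beta {n : ℕ} (hn : n ∈ indexSet) (y z : EnergySpace) (h : (y, z) ∈ op.graph)
    (hz : (Complex.I * (beta n : ℂ)) • y - z = 0) : y = 0 := by
  obtain ⟨hn0, m, he, rfl⟩ := hn
  have hm : 0 < m := Nat.pos_of_ne_zero fun h => by simp [h] at hn0
  have hm2 : (2 : ℝ) ≤ m := by
    obtain ⟨k, rfl⟩ := he
    have : 2 ≤ k + k := by omega
    exact_mod_cast this
  rw [beta_sq m hm] at hz
  refine injective_imaginary (by positivity) ?_ h hz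
  rw [(sin_cos_of_even hm he).1]
  exact lt_of_lt_of_le (by positivity) (two_div_le_sin hm2)

/-- The equation `(𝒜 - i β_n) y = f_n` has exactly one solution. -/
lemma exists_unique_solution {n : ℕ} (hn : n ∈ indexSet) : ∃ y : op.domain, ∀ z : op.domain,
    op z - (Complex.I * (beta n : ℂ)) • (z : EnergySpace) = forcing n ↔ z = y := by
  obtain ⟨x, w, hxw, hf⟩ := surjective_of_injective (injective_beta hn) (-forcing n)
  obtain ⟨y, rfl, rfl⟩ := (LinearPMap.mem_graph_iff op).1 hxw
  have hy : op y - (Complex.I * (beta n : ℂ)) • (y : EnergySpace) = forcing n := by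
    rw [← neg_inj, neg_sub, hf]
  refine ⟨y, fun z => ⟨fun hz => ?_, fun hz => hz ▸ hy⟩⟩
  refine Subtype.ext (sub_eq_zero.1 (injective_beta hn _ _
    (op.graph.sub_mem (op.mem_graph z) (op.mem_graph y)) ?_))
  have h1 := hz.trans hy.symm
  rw [← sub_eq_zero] at h1
  rw [← neg_eq_zero, ← h1, smul_sub]
  abel

lemma norm_forcing_le (n : ℕ) : ‖forcing n‖ ≤ 2 := by
  have h := norm_sq_energy (forcing n)
  change ‖forcing n‖ ^ 2 = ‖(0 : L2)‖ ^ 2 + ‖(0 : L2)‖ ^ 2 + ‖-toL2 (sinFun (beta n))‖ ^ 2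
    + ‖(0 : L2)‖ ^ 2 at h
  simp only [norm_zero, norm_neg, ne_eq, OfNat.ofNat_ne_zero, not_false_eq_true, zero_pow,
    zero_add, add_zero] at h
  rw [(pow_left_inj₀ (norm_nonneg _) (norm_nonneg _) two_ne_zero).1 h]
  exact norm_toL2_sinFun_le _

lemma tendsto_beta : Tendsto beta indexFilter atTop := by
  refine (tendsto_atTop_mono (fun n => ?_)
    (tendsto_natCast_atTop_atTop (R := ℝ))).mono_left inf_le_left
  have h1 : (n : ℝ) ≤ (n : ℝ) ^ 2 := by exact_mod_cast Nat.le_self_pow two_ne_zero n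
  have h2 : 0 ≤ 2 * √(n : ℝ) := by positivity
  have h3 : 0 ≤ 1 / (n : ℝ) := by positivity
  rw [beta]
  linarith

/-- Solutions of `(𝒜 - i β_n) y = f_n` are large. -/
lemma le_norm_of_eq_forcing {n : ℕ} (hn : n ∈ indexSet) {y : op.domain}
    (hy : op y - (Complex.I * (beta n : ℂ)) • (y : EnergySpace) = forcing n) :
    (Real.pi * (√(n : ℝ) / 8) - 16) / 6 ≤ ‖(y : EnergySpace)‖ := by
  obtain ⟨hn0, m, he, rfl⟩ := hn
  have hm : 0 < m := Nat.pos_of_ne_zero fun h => by simp [h] at hn0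
  rw [Nat.cast_pow, Real.sqrt_sq (Nat.cast_nonneg m)]
  refine le_norm_solution hm he ?_
  rw [← sub_eq_iff_eq_add'.1 hy]
  exact op.mem_graph y

lemma tendsto_lower_bound :
    Tendsto (fun n : ℕ => (Real.pi * (√(n : ℝ) / 8) - 16) / 6) indexFilter atTop := by
  have h1 : Tendsto (fun n : ℕ => √(n : ℝ)) indexFilter atTop :=
    (Real.tendsto_sqrt_atTop.comp tendsto_natCast_atTop_atTop).mono_left inf_le_left
  exact (tendsto_atTop_add_const_right _ _
    ((h1.atTop_div_const (by norm_num)).const_mul_atTop Real.pi_pos)).atTop_div_const (by norm_num)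

lemma eventually_indexFilter : ∀ᶠ n in indexFilter, n ∈ indexSet :=
  eventually_inf_principal.2 (Eventually.of_forall fun _ h => h)

instance : indexFilter.NeBot := by
  rw [indexFilter, inf_principal_neBot_iff]
  intro s hs
  obtain ⟨N, hN⟩ := mem_atTop_sets.1 hs
  refine ⟨(2 * (N + 1)) ^ 2, hN _ (by nlinarith), by positivity, _, even_two_mul _, rfl⟩

end StringBeam

theorem mainTheorem4 :
    -- `𝒜` generates exactly one `C₀`-semigroup, and this semigroup is not exponentially stable
    (∃! T : C0Semigroup StringBeam.EnergySpace, T.HasGenerator StringBeam.op) ∧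
    (∀ T : C0Semigroup StringBeam.EnergySpace,
      T.HasGenerator StringBeam.op → ¬ T.ExponentiallyStable) ∧
    -- the frequencies tend to infinity and the forcing terms are bounded
    Tendsto StringBeam.beta StringBeam.indexFilter atTop ∧
    (∃ C : ℝ, ∀ n ∈ StringBeam.indexSet, ‖StringBeam.forcing n‖ ≤ C) ∧
    -- `(𝒜 - iβ_n) y_n = f_n` has exactly one solution `y_n ∈ D(𝒜)`, and `‖y_n‖ → ∞`
    (∃ y : ℕ → StringBeam.op.domain,
      (∀ n ∈ StringBeam.indexSet, ∀ z : StringBeam.op.domain,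
        StringBeam.op z - (Complex.I * (StringBeam.beta n : ℂ)) • (z : StringBeam.EnergySpace)
          = StringBeam.forcing n ↔ z = y n) ∧
      Tendsto (fun n => ‖(y n : StringBeam.EnergySpace)‖) StringBeam.indexFilter atTop) ∧
    -- `iβ_n` is in the resolvent set of `𝒜`, and `‖(iβ_n - 𝒜)⁻¹‖ → ∞`
    (∃ R : ℕ → StringBeam.EnergySpace →L[ℂ] StringBeam.EnergySpace,
      (∀ n ∈ StringBeam.indexSet,
        IsResolventAt StringBeam.op (Complex.I * (StringBeam.beta n : ℂ)) (R n)) ∧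
      Tendsto (fun n => ‖R n‖) StringBeam.indexFilter atTop) := by
  have hy : ∀ n, ∃ y : StringBeam.op.domain, n ∈ StringBeam.indexSet →
      ∀ z : StringBeam.op.domain,
        StringBeam.op z - (Complex.I * (StringBeam.beta n : ℂ)) • (z : StringBeam.EnergySpace)
          = StringBeam.forcing n ↔ z = y := by
    intro n
    by_cases hn : n ∈ StringBeam.indexSet
    · obtain ⟨y, h⟩ := StringBeam.exists_unique_solution hn
      exact ⟨y, fun _ => h⟩
    · exact ⟨0, fun h => absurd h hn⟩
  choose y hy using hy
  have hR : ∀ n, ∃ R : StringBeam.EnergySpace →L[ℂ] StringBeam.EnergySpace,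
      n ∈ StringBeam.indexSet →
        IsResolventAt StringBeam.op (Complex.I * (StringBeam.beta n : ℂ)) R := by
    intro n
    by_cases hn : n ∈ StringBeam.indexSet
    · obtain ⟨R, h⟩ := StringBeam.isMaxDissipative_op.exists_isResolventAt
        (StringBeam.injective_beta hn)
        (StringBeam.surjective_of_injective (StringBeam.injective_beta hn))
      exact ⟨R, fun _ => h⟩
    · exact ⟨0, fun h => absurd h hn⟩
  choose R hR using hR
  have hsol : ∀ n ∈ StringBeam.indexSet,
      StringBeam.op (y n)
        - (Complex.I * (StringBeam.beta n : ℂ)) • (y n : StringBeam.EnergySpace)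
        = StringBeam.forcing n := fun n hn => (hy n hn (y n)).2 rfl
  have hgrow : Tendsto (fun n => ‖(y n : StringBeam.EnergySpace)‖) StringBeam.indexFilter atTop :=
    tendsto_atTop_mono' _ (StringBeam.eventually_indexFilter.mono fun n hn =>
      StringBeam.le_norm_of_eq_forcing hn (hsol n hn)) StringBeam.tendsto_lower_bound
  refine ⟨⟨StringBeam.isMaxDissipative_op.semigroup,
    StringBeam.isMaxDissipative_op.hasGenerator_semigroup, fun T hT =>
      hT.unique StringBeam.isMaxDissipative_op
        StringBeam.isMaxDissipative_op.hasGenerator_semigroup⟩,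
    fun T hT hs => ?_, StringBeam.tendsto_beta, ⟨2, fun n _ => StringBeam.norm_forcing_le n⟩,
    ⟨y, hy, hgrow⟩, ⟨R, hR, ?_⟩⟩
  · -- exponential stability would bound `yₙ` by a multiple of `fₙ`
    obtain ⟨K, hK, hb⟩ := hs.exists_norm_le hT
    obtain ⟨n, hn, hlt⟩ := (StringBeam.eventually_indexFilter.and
      (hgrow.eventually_gt_atTop (K * 2))).exists
    have h1 := hb (StringBeam.beta n) (StringBeam.op.mem_graph (y n))
    rw [hsol n hn] at h1
    have h2 := mul_le_mul_of_nonneg_left (StringBeam.norm_forcing_le n) hK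
    linarith
  · -- `yₙ = -Rₙ fₙ` and `‖fₙ‖ ≤ 2`
    refine tendsto_atTop_mono' _ (StringBeam.eventually_indexFilter.mono fun n hn => ?_)
      (hgrow.atTop_div_const two_pos)
    have h1 := (hR n hn).left_inv (y n)
    rw [← neg_sub, hsol n hn, map_neg] at h1
    have h2 : ‖(y n : StringBeam.EnergySpace)‖ ≤ ‖R n‖ * 2 := by
      rw [← h1, norm_neg]
      exact (R n).le_of_opNorm_le_of_le le_rfl (StringBeam.norm_forcing_le n)
    rw [div_le_iff₀ two_pos]
    exact h2
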